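/- For $n\ge 1$ let $\mathcal E_n$ be the set of unordered pairs $\{i,j\}$ with $i,j\in\{1,\dots,n^2\}$ and $|i-j|=1$ or $|i-j|=n$. Let $\mathcal A_n$ be the set of functions $u\colon(0,1]\to\{0,1\}$ that are constant on each interval $(\frac{i-1}{n^2},\frac{i}{n^2}]$, $i=1,\dots,n^2$, and write $u_i=u(i/n^2)$. Define $F_n\colon L^\infty(0,1)\to[0,+\infty]$ by $$F_n(u)=\frac1n\sum_{\{i,j\}\in\mathcal E_n}(u_i-u_j)^2\quad\text{if } u\in\mathcal A_n \text{ (up to a.e. equality)},\qquad F_n(u)=+\infty\ \text{ otherwise.}$$ Let $$F(u)=\begin{cases}2\,|\{x\in(0,1):0<u(x)<1\}|+|Du|(0,1)&\text{if }u\in BV(0,1)\text{ and }0\le u\le 1\text{ a.e.},\\+\infty&\text{otherwise,}\end{cases}$$ where $|\cdot|$ is Lebesgue measure, $|Du|(0,1)=\sup\{\int_0^1u\,\varphi'\,dx:\varphi\in C^1_c(0,1),\ |\varphi|\le1\}$ is the total variation of the distributional derivative of $u$, and $u\in BV(0,1)$ means that $u\in L^1(0,1)$ and $|Du|(0,1)<+\infty$.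 Then $F_n$ $\Gamma$-converges to $F$ with respect to weak-$*$ convergence in $L^\infty(0,1)$, that is: (i) if $u_n\overset{*}{\rightharpoonup}u$ in $L^\infty(0,1)$, then $F(u)\le\liminf_{n\to\infty}F_n(u_n)$; (ii) for every $u\in L^\infty(0,1)$ there are $u_n\in L^\infty(0,1)$ with $u_n\overset{*}{\rightharpoonup}u$ and $\limsup_{n\to\infty}F_n(u_n)\le F(u)$. Moreover, if $\sup_{n\ge1}F_n(u_n)<+\infty$, then there are a subsequence $(u_{n_k})$ and a function $u\in BV(0,1)$ such that $u_{n_k}\overset{*}{\rightharpoonup}u$ in $L^\infty(0,1)$ and $F(u)\le\liminf_{n\to\infty}F_n(u_n)$. -/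

import Mathlib

open MeasureTheory Set Filter Topology
open scoped ENNReal NNReal

noncomputable section

namespace SpinGamma

/-- Lebesgue measure on the interval `(0,1)`. -/
abbrev leb01 : Measure ℝ := volume.restrict (Ioo (0 : ℝ) 1)

/-- The space `L^∞(0,1)`. -/
abbrev Linf01 : Type := Lp ℝ ∞ leb01

/-- Weak-* convergence in `L^∞(0,1)`, the dual of `L^1(0,1)`. -/
def WeakStarConv (u : ℕ → Linf01) (v : Linf01) : Prop :=
  ∀ g : ℝ → ℝ, Integrable g leb01 →
    Tendsto (fun n => ∫ x, u n x * g x ∂leb01) atTop (𝓝 (∫ x, v x * g x ∂leb01))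

/-- (Sequential) `Γ`-convergence of the functionals `F n` to `G`, with respect to a notion of
convergence of sequences `conv`: the liminf inequality along every convergent sequence, and the
existence of a recovery sequence at every point. -/
def GammaConverges {X : Type*} (conv : (ℕ → X) → X → Prop) (F : ℕ → X → ℝ≥0∞) (G : X → ℝ≥0∞) :
    Prop :=
  (∀ (x : X) (y : ℕ → X), conv y x → G x ≤ liminf (fun n => F n (y n)) atTop) ∧
  (∀ x : X, ∃ y : ℕ → X, conv y x ∧ limsup (fun n => F n (y n)) atTop ≤ G x)

/-- The edges `{i,j}` with `i, j ∈ {1,…,n²}` and `|i - j| = 1` or `|i - j| = n`; each unordered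
pair is listed once, with its smaller element first. -/
def edges (n : ℕ) : Finset (ℕ × ℕ) :=
  (Finset.Icc 1 (n ^ 2) ×ˢ Finset.Icc 1 (n ^ 2)).filter
    (fun p => p.1 < p.2 ∧ (p.2 - p.1 = 1 ∨ p.2 - p.1 = n))

/-- The class `𝒜_n` of functions `(0,1] → {0,1}` that are constant on each interval
`((i-1)/n², i/n²]`, `i = 1, …, n²`. Values outside `(0,1]` play no role. -/
def spinFunctions (n : ℕ) : Set (ℝ → ℝ) :=
  {v | (∀ x ∈ Ioc (0 : ℝ) 1, v x = 0 ∨ v x = 1) ∧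
    ∀ i ∈ Finset.Icc 1 (n ^ 2),
      ∀ x ∈ Ioc (((i : ℝ) - 1) / (n : ℝ) ^ 2) ((i : ℝ) / (n : ℝ) ^ 2),
      ∀ y ∈ Ioc (((i : ℝ) - 1) / (n : ℝ) ^ 2) ((i : ℝ) / (n : ℝ) ^ 2), v x = v y}

/-- `(1/n) ∑ (v_i - v_j)²` over the edges, where `v_i = v(i/n²)`. -/
def spinEnergy (n : ℕ) (v : ℝ → ℝ) : ℝ :=
  (1 / (n : ℝ)) *
    ∑ p ∈ edges n, (v ((p.1 : ℝ) / (n : ℝ) ^ 2) - v ((p.2 : ℝ) / (n : ℝ) ^ 2)) ^ 2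

/-- The functional `F_n` on `L^∞(0,1)`: the spin energy on (classes of) functions of `𝒜_n`, and
`+∞` elsewhere. For `n ≥ 1` a class contains functions `v ∈ 𝒜_n` with only one restriction to
`(0,1]`, so the infimum is over at most one value. -/
def discreteFunctional (n : ℕ) (u : Linf01) : ℝ≥0∞ :=
  ⨅ (v : ℝ → ℝ) (_ : v ∈ spinFunctions n) (_ : u =ᵐ[leb01] v), ENNReal.ofReal (spinEnergy n v)

/-- Admissible test functions for the variation: `φ ∈ C¹_c(0,1)` with `|φ| ≤ 1`. -/
def testFunctions : Set (ℝ → ℝ) :=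
  {φ | ContDiff ℝ 1 φ ∧ HasCompactSupport φ ∧ tsupport φ ⊆ Ioo 0 1 ∧ ∀ x, |φ x| ≤ 1}

/-- The total variation `|Du|(0,1)` of the distributional derivative. -/
def totalVar (u : ℝ → ℝ) : ℝ≥0∞ :=
  ⨆ φ ∈ testFunctions, ENNReal.ofReal (∫ x, u x * deriv φ x ∂leb01)

/-- `u ∈ BV(0,1)`. -/
def MemBV (u : ℝ → ℝ) : Prop :=
  Integrable u leb01 ∧ totalVar u < ∞

open scoped Classical in
/-- The limit functional `F`. -/
def limitFunctional (u : Linf01) : ℝ≥0∞ :=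
  if MemBV u ∧ ∀ᵐ x ∂leb01, 0 ≤ u x ∧ u x ≤ 1 then
    2 * volume {x ∈ Ioo (0 : ℝ) 1 | 0 < u x ∧ u x < 1} + totalVar u
  else ∞

end SpinGamma

end

noncomputable section

namespace SpinGamma

/-! Read the sites, numbered from 0, as an n × n array whose rows are blocks of n consecutive sites.
A row occupies an interval of length 1/n; bonds at distance 1 run along rows (and from the end of a
row to the start of the next), and bonds at distance n join neighbouring rows. A weak-* limit u
records the density of ones per row. If H and V count the broken bonds of the two kinds, then F_n =
(H + V)/n for n ≥ 2. A row containing both values costs about two horizontal bonds, which produces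
2|{0 < u < 1}|, while V/n is a difference quotient of the step function in L¹ and produces |Du|.

Lower bound. Put s = 1/n and let w_n be the average of u_n over [x, x + s]. It lies strictly between
0 and 1 only if the window of sites met by the average is mixed. A mixed window whose ends agree has
two jumps, and each bond lies in at most n windows, so 2·#mixed ≤ nH + 2V (`card_mixedWindows_le`),
where 2V is negligible after division by n². Since V/n bounds the variation of w_n, the weak
convergence of u_n becomes strong L¹ convergence of w_n to u (`tendsto_integral_windowAverage`), so
{δ ≤ u ≤ 1 - δ} is almost contained in {0 < w_n < 1}. Moving the shift onto a test function φ bounds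
V/n below by a quantity tending to ∫ u φ'. The two estimates use different bonds and therefore add
up (`volume_middle_add_le`).

Upper bound. For u in BV with values in [0,1], sample u at the points (r + t)/n, off a null set
where the pointwise variation is at most |Du|. Averaging over t gives a t with at most n|{0 < u <
1}| samples strictly between 0 and 1. Round n·u to integers k_r with one common random offset: this
preserves 0 and n and, for a suitable offset, does not increase the variation. Let row r begin with
k_r ones. Then V is at most n|Du|, and H is at most twice the number of mixed rows plus O(1).

Compactness. Finite energy forces values in [0,1], and bounded sets of L² are weakly sequentially
compact. Extracting along indices whose energies tend to the liminf makes the lower bound give F(u)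
≤ liminf F_n(u_n), hence also u ∈ BV. -/

/-! ### Broken bonds and mixed windows -/

/-- Number of sign changes between consecutive sites. -/
def horizontalJumps (n : ℕ) (b : ℕ → ℝ) : ℝ :=
  ∑ i ∈ Finset.range (n ^ 2 - 1), (b i - b (i + 1)) ^ 2

/-- Number of sign changes between sites at distance `n`. -/
def verticalJumps (n : ℕ) (b : ℕ → ℝ) : ℝ :=
  ∑ i ∈ Finset.range (n ^ 2 - n), (b i - b (i + n)) ^ 2

/-- The values of `v` on the sites, numbered from `0`. -/
def siteValues (n : ℕ) (v : ℝ → ℝ) (i : ℕ) : ℝ := v (((i + 1 : ℕ) : ℝ) / (n : ℝ) ^ 2)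

lemma horizontalJumps_nonneg (n : ℕ) (b : ℕ → ℝ) : 0 ≤ horizontalJumps n b :=
  Finset.sum_nonneg fun _ _ => sq_nonneg _

lemma verticalJumps_nonneg (n : ℕ) (b : ℕ → ℝ) : 0 ≤ verticalJumps n b :=
  Finset.sum_nonneg fun _ _ => sq_nonneg _

lemma sum_edges {n : ℕ} (hn : 2 ≤ n) (f : ℕ × ℕ → ℝ) :
    ∑ p ∈ edges n, f p = ∑ i ∈ Finset.range (n ^ 2 - 1), f (i + 1, i + 2) +
      ∑ i ∈ Finset.range (n ^ 2 - n), f (i + 1, i + 1 + n) := by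
  have hnn : n ≤ n ^ 2 := by nlinarith
  set A := (Finset.range (n ^ 2 - 1)).image fun i : ℕ => (i + 1, i + 2)
  set B := (Finset.range (n ^ 2 - n)).image fun i : ℕ => (i + 1, i + 1 + n)
  have hE : edges n = A ∪ B := by
    ext ⟨p, q⟩
    simp only [edges, A, B, Finset.mem_filter, Finset.mem_product, Finset.mem_Icc,
      Finset.mem_union, Finset.mem_image, Finset.mem_range, Prod.mk.injEq]
    constructor
    · rintro ⟨⟨⟨h1, h2⟩, h3, h4⟩, h5, h6 | h6⟩
      · exact Or.inl ⟨p - 1, by omega, by omega, by omega⟩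
      · exact Or.inr ⟨p - 1, by omega, by omega, by omega⟩
    · rintro (⟨i, h1, rfl, rfl⟩ | ⟨i, h1, rfl, rfl⟩) <;> omega
  -- A pair in both families would force n = 1; this is where 2 ≤ n matters.
  have hd : Disjoint A B := by
    rw [Finset.disjoint_left]
    rintro ⟨p, q⟩ h1 h2
    simp only [A, B, Finset.mem_image, Finset.mem_range, Prod.mk.injEq] at h1 h2
    obtain ⟨i, -, h3, h4⟩ := h1
    obtain ⟨j, -, h5, h6⟩ := h2
    omega
  rw [hE, Finset.sum_union hd, Finset.sum_image, Finset.sum_image]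
  · intro i _ j _ h
    simp only [Prod.mk.injEq] at h
    omega
  · intro i _ j _ h
    simp only [Prod.mk.injEq] at h
    omega

lemma spinEnergy_eq {n : ℕ} (hn : 2 ≤ n) (v : ℝ → ℝ) :
    spinEnergy n v =
      (1 / (n : ℝ)) * (horizontalJumps n (siteValues n v) + verticalJumps n (siteValues n v)) := by
  rw [spinEnergy, sum_edges hn, horizontalJumps, verticalJumps]
  congr 2
  refine Finset.sum_congr rfl fun i _ => ?_
  simp only [siteValues]
  congr 3
  push_cast
  ring

lemma abs_sub_le_sum_sq {b : ℕ → ℝ} {i m : ℕ} (him : i ≤ m)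
    (hb : ∀ j ∈ Finset.Icc i m, b j = 0 ∨ b j = 1) :
    |b i - b m| ≤ ∑ j ∈ Finset.Ico i m, (b j - b (j + 1)) ^ 2 := by
  induction m, him using Nat.le_induction with
  | base => simp
  | succ m him ih =>
    rw [Finset.sum_Ico_succ_top him]
    have h1 := ih fun j hj => hb j (by simp only [Finset.mem_Icc] at hj ⊢; omega)
    have h2 : |b m - b (m + 1)| ≤ (b m - b (m + 1)) ^ 2 := by
      rcases hb m (by simp; omega) with h | h <;>
        rcases hb (m + 1) (by simp; omega) with h' | h' <;> rw [h, h'] <;> norm_num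
    linarith [abs_sub_le (b i) (b m) (b (m + 1))]

/-- A nonconstant window whose end points agree contains at least two sign changes. -/
lemma two_le_sum_window {b : ℕ → ℝ} {i n m : ℕ} (hm : m ∈ Finset.Icc i (i + n))
    (hb : ∀ j ∈ Finset.Icc i (i + n), b j = 0 ∨ b j = 1) (hne : b m ≠ b i) :
    2 - 2 * (b i - b (i + n)) ^ 2 ≤ ∑ j ∈ Finset.Ico i (i + n), (b j - b (j + 1)) ^ 2 := by
  rw [Finset.mem_Icc] at hm
  have h1 : |b i - b m| ≤ ∑ j ∈ Finset.Ico i m, (b j - b (j + 1)) ^ 2 :=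
    abs_sub_le_sum_sq hm.1 fun j hj => hb j (by simp only [Finset.mem_Icc] at hj ⊢; omega)
  have h2 : |b m - b (i + n)| ≤ ∑ j ∈ Finset.Ico m (i + n), (b j - b (j + 1)) ^ 2 :=
    abs_sub_le_sum_sq hm.2 fun j hj => hb j (by simp only [Finset.mem_Icc] at hj ⊢; omega)
  -- Leaving the value `b i` costs one jump before `m`, returning to it costs another after `m`. If
  -- the ends differ, the left-hand side is 0.
  rw [← Finset.sum_Ico_consecutive _ hm.1 hm.2]
  refine le_trans ?_ (add_le_add h1 h2)
  rcases hb i (by simp) with h | h <;> rcases hb m (by simp; omega) with h' | h' <;>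
    rcases hb (i + n) (by simp) with h'' | h'' <;> rw [h, h'] at hne <;>
    rw [h, h', h''] <;> first | exact absurd rfl hne | norm_num

/-- Double counting: a bond lies in at most n windows, one for each offset from the start of the
window. -/
lemma sum_windows_le {n : ℕ} {h : ℕ → ℝ} (h0 : ∀ i, 0 ≤ h i) :
    ∑ i ∈ Finset.range (n ^ 2 - n), ∑ j ∈ Finset.Ico i (i + n), h j ≤
      n * ∑ i ∈ Finset.range (n ^ 2 - 1), h i := by
  have h1 : ∀ i, ∑ j ∈ Finset.Ico i (i + n), h j = ∑ j ∈ Finset.range n, h (i + j) := fun i => by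
    rw [Finset.sum_Ico_eq_sum_range]; simp
  simp_rw [h1]
  rw [Finset.sum_comm]
  calc _ ≤ ∑ j ∈ Finset.range n, ∑ i ∈ Finset.range (n ^ 2 - 1), h i := by
        refine Finset.sum_le_sum fun j hj => ?_
        rw [Finset.mem_range] at hj
        have h2 := Finset.sum_map (Finset.range (n ^ 2 - n)) (addRightEmbedding j) h
        simp only [addRightEmbedding_apply] at h2
        rw [← h2]
        refine Finset.sum_le_sum_of_subset_of_nonneg ?_ fun i _ _ => h0 i
        intro x hx
        simp only [Finset.mem_map, Finset.mem_range, addRightEmbedding_apply] at hx ⊢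
        obtain ⟨i, hi, rfl⟩ := hx
        omega
    _ = _ := by simp

open scoped Classical in
/-- The starting points of the windows of length `n` on which `b` is not constant. -/
def mixedWindows (n : ℕ) (b : ℕ → ℝ) : Finset ℕ :=
  (Finset.range (n ^ 2 - n)).filter fun i => ∃ m ∈ Finset.Icc i (i + n), b m ≠ b i

/-- Sum the two-jump bound over all windows. The correction by vertical jumps is O(n) at bounded
energy, hence negligible after division by n². -/
lemma card_mixedWindows_le {n : ℕ} {b : ℕ → ℝ}
    (hb : ∀ j < n ^ 2, b j = 0 ∨ b j = 1) :
    2 * ((mixedWindows n b).card : ℝ) - 2 * verticalJumps n b ≤ n * horizontalJumps n b := by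
  classical
  refine le_trans ?_ (sum_windows_le (n := n) (h := fun j => (b j - b (j + 1)) ^ 2)
    fun i => sq_nonneg _)
  rw [verticalJumps, mixedWindows, Finset.card_filter, Finset.mul_sum]
  push_cast
  rw [Finset.mul_sum, ← Finset.sum_sub_distrib]
  refine Finset.sum_le_sum fun i hi => ?_
  rw [Finset.mem_range] at hi
  split_ifs with h
  · obtain ⟨m, hm, hne⟩ := h
    rw [mul_one]
    exact two_le_sum_window hm (fun j hj => hb j (by simp only [Finset.mem_Icc] at hj; omega)) hne
  · have : 0 ≤ ∑ j ∈ Finset.Ico i (i + n), (b j - b (j + 1)) ^ 2 :=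
      Finset.sum_nonneg fun _ _ => sq_nonneg _
    nlinarith [sq_nonneg (b i - b (i + n))]

/-! ### Window averages and variation under translation -/

lemma intervalIntegrable_of_bounded {f : ℝ → ℝ} {K : ℝ} (hf : Measurable f)
    (hb : ∀ x, |f x| ≤ K) (a b : ℝ) : IntervalIntegrable f volume a b := by
  rw [intervalIntegrable_iff]
  exact Measure.integrableOn_of_bounded (M := K) (by simp) hf.aestronglyMeasurable
    (Eventually.of_forall hb)

/-- The average of `f` over `[x, x + h]`. -/
def windowAverage (h : ℝ) (f : ℝ → ℝ) (x : ℝ) : ℝ := (1 / h) * ∫ y in x..(x + h), f y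

lemma abs_integral_le_of_bounded {f : ℝ → ℝ} (hb : ∀ x, |f x| ≤ 1) (a b : ℝ) :
    |∫ y in a..b, f y| ≤ |b - a| := by
  have := intervalIntegral.norm_integral_le_of_norm_le_const (f := f) (a := a) (b := b) (C := 1)
    fun x _ => hb x
  simpa using this

lemma continuous_primitive_of_bounded {f : ℝ → ℝ} (hf : Measurable f)
    (hb : ∀ x, |f x| ≤ 1) (a : ℝ) : Continuous fun x => ∫ y in a..x, f y :=
  intervalIntegral.continuous_primitive (fun a b => intervalIntegrable_of_bounded hf hb a b) a

lemma continuous_windowAverage {f : ℝ → ℝ} (hf : Measurable f)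
    (hb : ∀ x, |f x| ≤ 1) (h : ℝ) : Continuous (windowAverage h f) := by
  have h1 : windowAverage h f =
      fun x => (1 / h) * ((∫ y in (0 : ℝ)..(x + h), f y) - ∫ y in (0 : ℝ)..x, f y) := by
    funext x
    rw [windowAverage, intervalIntegral.integral_interval_sub_left] <;>
      exact intervalIntegrable_of_bounded hf hb _ _
  rw [h1]
  have h2 := continuous_primitive_of_bounded hf hb 0
  exact continuous_const.mul ((h2.comp (continuous_add_const h)).sub h2)

lemma abs_windowAverage_le {f : ℝ → ℝ} (hb : ∀ x, |f x| ≤ 1) {h : ℝ} (hh : 0 < h) (x : ℝ) :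
    |windowAverage h f x| ≤ 1 := by
  rw [windowAverage, abs_mul, abs_of_pos (by positivity : 0 < 1 / h)]
  have := abs_integral_le_of_bounded hb x (x + h)
  rw [add_sub_cancel_left, abs_of_pos hh] at this
  calc 1 / h * |∫ y in x..(x + h), f y| ≤ 1 / h * h := by gcongr
    _ = 1 := by field_simp

/-- The scaled variation of `f` under translation by `s`, up to `x`. -/
def shiftVariation (s : ℝ) (f : ℝ → ℝ) (x : ℝ) : ℝ :=
  (1 / s) * ∫ y in (0 : ℝ)..x, |f (y + s) - f y|

lemma shift_bound {f : ℝ → ℝ} (hb : ∀ x, |f x| ≤ 1) (s : ℝ) (x : ℝ) :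
    |f (x + s) - f x| ≤ 2 := by
  have := abs_sub (f (x + s)) (f x)
  linarith [hb x, hb (x + s)]

lemma intervalIntegrable_shift {f : ℝ → ℝ} (hf : Measurable f) (hb : ∀ x, |f x| ≤ 1)
    (s a b : ℝ) : IntervalIntegrable (fun y => |f (y + s) - f y|) volume a b :=
  intervalIntegrable_of_bounded (K := 2)
    (((hf.comp (measurable_id.add_const s)).sub hf).abs)
    (fun x => by rw [abs_abs]; exact shift_bound hb s x) a b

lemma shiftVariation_sub {f : ℝ → ℝ} (hf : Measurable f) (hb : ∀ x, |f x| ≤ 1) (s x y : ℝ) :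
    shiftVariation s f y - shiftVariation s f x =
      (1 / s) * ∫ z in x..y, |f (z + s) - f z| := by
  rw [shiftVariation, shiftVariation, ← mul_sub, intervalIntegral.integral_interval_sub_left] <;>
    exact intervalIntegrable_shift hf hb _ _ _

lemma shiftVariation_mono {f : ℝ → ℝ} (hf : Measurable f) (hb : ∀ x, |f x| ≤ 1) {s : ℝ}
    (hs : 0 < s) : Monotone (shiftVariation s f) := by
  intro x y hxy
  rw [← sub_nonneg, shiftVariation_sub hf hb]
  exact mul_nonneg (by positivity) (intervalIntegral.integral_nonneg hxy fun _ _ => abs_nonneg _)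

lemma continuous_shiftVariation {f : ℝ → ℝ} (hf : Measurable f) (hb : ∀ x, |f x| ≤ 1) (s : ℝ) :
    Continuous (shiftVariation s f) :=
  continuous_const.mul (intervalIntegral.continuous_primitive
    (fun a b => intervalIntegrable_shift hf hb s a b) 0)

/-- The average over [x, x + s] has derivative (f(x + s) - f(x))/s, whose absolute value is the
density of `shiftVariation`. -/
lemma abs_windowAverage_sub_le {f : ℝ → ℝ} (hf : Measurable f) (hb : ∀ x, |f x| ≤ 1) {s : ℝ}
    (hs : 0 < s) {x y : ℝ} (hxy : x ≤ y) :
    |windowAverage s f y - windowAverage s f x| ≤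
      shiftVariation s f y - shiftVariation s f x := by
  have hi := fun a b => intervalIntegrable_of_bounded hf hb a b
  have hc : ∀ a b, IntervalIntegrable (fun z => f (z + s)) volume a b := fun a b =>
    intervalIntegrable_of_bounded (hf.comp (measurable_id.add_const s)) (fun z => hb (z + s)) a b
  have h1 : windowAverage s f y - windowAverage s f x =
      (1 / s) * ∫ z in x..y, (f (z + s) - f z) := by
    rw [windowAverage, windowAverage, ← mul_sub, intervalIntegral.integral_sub (hc _ _) (hi _ _),
      intervalIntegral.integral_comp_add_right]
    congr 1
    rw [intervalIntegral.integral_interval_sub_interval_comm' (hi _ _) (hi _ _) (hi _ _)]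
  rw [h1, shiftVariation_sub hf hb, abs_mul, abs_of_pos (by positivity : 0 < 1 / s)]
  gcongr
  exact intervalIntegral.abs_integral_le_integral_abs hxy

lemma abs_integral_primitive_sub_le {f : ℝ → ℝ} (hf : Measurable f) (hb : ∀ x, |f x| ≤ 1)
    {s : ℝ} (hs : 0 < s) (z : ℝ) :
    |(∫ y in z..(z + s), ∫ t in (0 : ℝ)..y, f t) - s * ∫ t in (0 : ℝ)..z, f t| ≤ s * s := by
  have hi := fun a b => intervalIntegrable_of_bounded hf hb a b
  have h1 : (∫ y in z..(z + s), ∫ t in (0 : ℝ)..y, f t) - s * ∫ t in (0 : ℝ)..z, f t =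
      ∫ y in z..(z + s), ((∫ t in (0 : ℝ)..y, f t) - ∫ t in (0 : ℝ)..z, f t) := by
    rw [intervalIntegral.integral_sub
      ((continuous_primitive_of_bounded hf hb 0).intervalIntegrable _ _) (by simp)]
    simp
  rw [h1]
  have h2 := intervalIntegral.norm_integral_le_of_norm_le_const (a := z) (b := z + s) (C := s)
    (f := fun y => (∫ t in (0 : ℝ)..y, f t) - ∫ t in (0 : ℝ)..z, f t) ?_
  · simpa [abs_of_pos hs] using h2
  · intro y hy
    rw [uIoc_of_le (by linarith)] at hy
    rw [intervalIntegral.integral_interval_sub_left (hi _ _) (hi _ _)]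
    refine (abs_integral_le_of_bounded hb z y).trans ?_
    rw [abs_of_pos (by linarith [hy.1])]
    linarith [hy.2]

lemma integral_translate_sub {F : ℝ → ℝ} (hF : Continuous F) (s a b : ℝ) :
    ∫ y in a..b, (F (y + s) - F y) = (∫ y in b..(b + s), F y) - ∫ y in a..(a + s), F y := by
  have hi : ∀ a b, IntervalIntegrable F volume a b := fun a b => hF.intervalIntegrable a b
  have hs : Continuous fun y => F (y + s) := hF.comp (continuous_add_const s)
  rw [intervalIntegral.integral_sub (hs.intervalIntegrable _ _) (hi _ _),
    intervalIntegral.integral_comp_add_right,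
    intervalIntegral.integral_interval_sub_interval_comm' (hi _ _) (hi _ _) (hi _ _)]

/-- Averaging first at scale s disturbs the average at scale h only near the two ends of the window.
Each end contributes at most s², because the primitive of f is 1-Lipschitz, and the prefactor is
1/(hs). -/
lemma abs_windowAverage_comp_sub_le {f : ℝ → ℝ} (hf : Measurable f) (hb : ∀ x, |f x| ≤ 1)
    {s h : ℝ} (hs : 0 < s) (hh : 0 < h) (x : ℝ) :
    |windowAverage h (windowAverage s f) x - windowAverage h f x| ≤ 2 * s / h := by
  have hi := fun a b => intervalIntegrable_of_bounded hf hb a b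
  have hF := continuous_primitive_of_bounded hf hb 0
  set F : ℝ → ℝ := fun x => ∫ y in (0 : ℝ)..x, f y with hFdef
  have hw : windowAverage s f = fun x => (1 / s) * (F (x + s) - F x) := by
    funext x
    rw [windowAverage, hFdef]
    simp only
    rw [intervalIntegral.integral_interval_sub_left (hi _ _) (hi _ _)]
  have h1 : ∫ y in x..(x + h), (F (y + s) - F y) =
      (∫ y in (x + h)..(x + h + s), F y) - ∫ y in x..(x + s), F y :=
    integral_translate_sub hF s x (x + h)
  have h2 := abs_integral_primitive_sub_le hf hb hs x
  have h3 := abs_integral_primitive_sub_le hf hb hs (x + h)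
  have h4 : windowAverage h f x = (1 / h) * (F (x + h) - F x) := by
    rw [windowAverage, hFdef]
    simp only
    rw [intervalIntegral.integral_interval_sub_left (hi _ _) (hi _ _)]
  rw [h4, hw, windowAverage, intervalIntegral.integral_const_mul, h1]
  have h5 : 1 / h * (1 / s * ((∫ y in (x + h)..(x + h + s), F y) - ∫ y in x..(x + s), F y)) -
      1 / h * (F (x + h) - F x) = 1 / (h * s) *
      (((∫ y in (x + h)..(x + h + s), F y) - s * F (x + h)) -
        ((∫ y in x..(x + s), F y) - s * F x)) := by
    field_simp
    ring
  rw [h5, abs_mul, abs_of_pos (by positivity)]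
  calc _ ≤ 1 / (h * s) * (s * s + s * s) := by
        gcongr
        exact (abs_sub _ _).trans (add_le_add h3 h2)
    _ = _ := by field_simp; ring

/-- Compares the vanishing scale s with a fixed scale h through the iterated average: averaging at
scale h moves the s-average by at most its variation on [x, x + h]. -/
lemma abs_windowAverage_sub_windowAverage_le {f : ℝ → ℝ} (hf : Measurable f)
    (hb : ∀ x, |f x| ≤ 1) {s h : ℝ} (hs : 0 < s) (hh : 0 < h) (x : ℝ) :
    |windowAverage s f x - windowAverage h f x| ≤
      (shiftVariation s f (x + h) - shiftVariation s f x) + 2 * s / h := by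
  have h1 := abs_windowAverage_comp_sub_le hf hb hs hh x
  have h2 : |windowAverage h (windowAverage s f) x - windowAverage s f x| ≤
      shiftVariation s f (x + h) - shiftVariation s f x := by
    have hc := continuous_windowAverage hf hb s
    have h3 : windowAverage h (windowAverage s f) x - windowAverage s f x =
        (1 / h) * ∫ y in x..(x + h), (windowAverage s f y - windowAverage s f x) := by
      rw [intervalIntegral.integral_sub (hc.intervalIntegrable _ _) (by simp), windowAverage]
      simp only [intervalIntegral.integral_const, add_sub_cancel_left, smul_eq_mul]
      field_simp
    rw [h3, abs_mul, abs_of_pos (by positivity : 0 < 1 / h)]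
    have h4 := intervalIntegral.norm_integral_le_of_norm_le_const (a := x) (b := x + h)
      (C := shiftVariation s f (x + h) - shiftVariation s f x)
      (f := fun y => windowAverage s f y - windowAverage s f x) ?_
    · rw [add_sub_cancel_left, abs_of_pos hh, Real.norm_eq_abs] at h4
      calc _ ≤ 1 / h * ((shiftVariation s f (x + h) - shiftVariation s f x) * h) := by gcongr
        _ = _ := by field_simp
    · intro y hy
      rw [uIoc_of_le (by linarith)] at hy
      refine (abs_windowAverage_sub_le hf hb hs hy.1.le).trans ?_
      linarith [shiftVariation_mono hf hb hs hy.2]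
  rw [abs_le] at h1 h2 ⊢
  constructor <;> linarith [h1.1, h1.2, h2.1, h2.2]

/-- The integral of a translation increment telescopes to two end integrals over intervals of length
h. The hypothesis `hsh` keeps the upper one below 1 - s, so the bound is linear in h. -/
lemma integral_shiftVariation_sub_le {f : ℝ → ℝ} (hf : Measurable f)
    (hb : ∀ x, |f x| ≤ 1) {s h η : ℝ} (hs : 0 < s) (hh : 0 < h) (hsh : s + h ≤ η) :
    ∫ x in (0 : ℝ)..(1 - η), (shiftVariation s f (x + h) - shiftVariation s f x) ≤
      h * shiftVariation s f (1 - s) := by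
  have hc := continuous_shiftVariation hf hb s
  have hi : ∀ a b, IntervalIntegrable (shiftVariation s f) volume a b := fun a b =>
    hc.intervalIntegrable a b
  have hm := shiftVariation_mono hf hb hs
  have h0 : shiftVariation s f 0 = 0 := by simp [shiftVariation]
  rw [integral_translate_sub hc]
  have h1 : 0 ≤ ∫ x in (0 : ℝ)..(0 + h), shiftVariation s f x := by
    refine intervalIntegral.integral_nonneg (by linarith) fun x hx => ?_
    rw [← h0]; exact hm hx.1
  have h2 : ∫ x in (1 - η)..(1 - η + h), shiftVariation s f x ≤
      ∫ x in (1 - η)..(1 - η + h), shiftVariation s f (1 - s) := by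
    refine intervalIntegral.integral_mono_on (by linarith) (hi _ _) (by simp) fun x hx => hm ?_
    linarith [hx.2]
  simp only [intervalIntegral.integral_const, add_sub_cancel_left, smul_eq_mul] at h2
  linarith

/-! ### From weak convergence to strong convergence of averages -/

/-- Lebesgue differentiation and dominated convergence. -/
lemma tendsto_integral_windowAverage_sub_self {v : ℝ → ℝ} (hv : Measurable v)
    (hvb : ∀ x, |v x| ≤ 1) (a b : ℝ) :
    Tendsto (fun h => ∫ x in a..b, |windowAverage h v x - v x|) (𝓝[>] 0) (𝓝 0) := by
  have hli : LocallyIntegrable v volume :=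
    (locallyIntegrable_const (1 : ℝ)).mono hv.aestronglyMeasurable
      (Eventually.of_forall fun x => by simpa using hvb x)
  have h0 : (0 : ℝ) = ∫ x in a..b, (0 : ℝ) := by simp
  conv => rhs; rw [h0]
  refine intervalIntegral.tendsto_integral_filter_of_dominated_convergence (fun _ => 2) ?_ ?_
    (by simp) ?_
  · exact Eventually.of_forall fun h =>
      ((continuous_windowAverage hv hvb h).measurable.sub hv).abs.aestronglyMeasurable
  · filter_upwards [self_mem_nhdsWithin] with h hh
    refine Eventually.of_forall fun x _ => ?_
    rw [Real.norm_eq_abs, abs_abs]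
    linarith [abs_sub (windowAverage h v x) (v x), abs_windowAverage_le hvb hh x, hvb x]
  · filter_upwards [_root_.LocallyIntegrable.ae_hasDerivAt_integral hli] with x hx _
    have h1 := (hx 0).tendsto_slope_zero_right
    have h2 : Tendsto (fun h => |windowAverage h v x - v x|) (𝓝[>] 0) (𝓝 |v x - v x|) := by
      refine ((h1.congr fun h => ?_).sub_const _).abs
      rw [windowAverage, intervalIntegral.integral_interval_sub_left
        (intervalIntegrable_of_bounded hv hvb _ _) (intervalIntegrable_of_bounded hv hvb _ _)]
      simp
    simpa using h2

/-- At a fixed scale an average is a difference of two primitives, so it converges pointwise. The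
condition h ≤ η keeps x + h inside [0,1]. -/
lemma tendsto_integral_windowAverage_sub {f : ℕ → ℝ → ℝ} {v : ℝ → ℝ}
    (hf : ∀ k, Measurable (f k)) (hfb : ∀ k x, |f k x| ≤ 1) (hv : Measurable v)
    (hvb : ∀ x, |v x| ≤ 1)
    (hconv : ∀ x ∈ Icc (0 : ℝ) 1,
      Tendsto (fun k => ∫ y in (0 : ℝ)..x, f k y) atTop (𝓝 (∫ y in (0 : ℝ)..x, v y)))
    {h η : ℝ} (hh : 0 < h) (hη : h ≤ η) (hη1 : η ≤ 1) :
    Tendsto (fun k => ∫ x in (0 : ℝ)..(1 - η), |windowAverage h (f k) x - windowAverage h v x|)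
      atTop (𝓝 0) := by
  have h0 : (0 : ℝ) = ∫ x in (0 : ℝ)..(1 - η), (0 : ℝ) := by simp
  conv => rhs; rw [h0]
  refine intervalIntegral.tendsto_integral_filter_of_dominated_convergence (fun _ => 2) ?_ ?_
    (by simp) ?_
  · exact Eventually.of_forall fun k => ((continuous_windowAverage (hf k) (hfb k) h).sub
      (continuous_windowAverage hv hvb h)).abs.aestronglyMeasurable
  · refine Eventually.of_forall fun k => Eventually.of_forall fun x _ => ?_
    rw [Real.norm_eq_abs, abs_abs]
    linarith [abs_sub (windowAverage h (f k) x) (windowAverage h v x),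
      abs_windowAverage_le (hfb k) hh x, abs_windowAverage_le hvb hh x]
  · refine Eventually.of_forall fun x hx => ?_
    rw [uIoc_of_le (by linarith)] at hx
    have h1 := ((hconv (x + h) ⟨by linarith [hx.1], by linarith [hx.2]⟩).sub
      (hconv x ⟨by linarith [hx.1], by linarith [hx.2]⟩)).const_mul (1 / h)
    have h2 : Tendsto (fun k => |windowAverage h (f k) x - windowAverage h v x|) atTop
        (𝓝 |windowAverage h v x - windowAverage h v x|) := by
      have h3 : ∀ g : ℝ → ℝ, Measurable g → (∀ x, |g x| ≤ 1) → (1 / h) *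
          ((∫ y in (0 : ℝ)..(x + h), g y) - ∫ y in (0 : ℝ)..x, g y) = windowAverage h g x := by
        intro g hg hgb
        rw [windowAverage, intervalIntegral.integral_interval_sub_left
          (intervalIntegrable_of_bounded hg hgb _ _) (intervalIntegrable_of_bounded hg hgb _ _)]
      rw [h3 v hv hvb] at h1
      exact ((h1.congr fun k => h3 _ (hf k) (hfb k)).sub_const _).abs
    simpa using h2

/-- Averages over short windows converge strongly if the variation under translation by the
window length is controlled. -/
lemma tendsto_integral_windowAverage {f : ℕ → ℝ → ℝ} {v : ℝ → ℝ} {s : ℕ → ℝ} {C : ℝ}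
    (hf : ∀ k, Measurable (f k)) (hfb : ∀ k x, |f k x| ≤ 1) (hv : Measurable v)
    (hvb : ∀ x, |v x| ≤ 1) (hs : ∀ k, 0 < s k) (hs0 : Tendsto s atTop (𝓝 0))
    (hC : ∀ k, shiftVariation (s k) (f k) (1 - s k) ≤ C)
    (hconv : ∀ x ∈ Icc (0 : ℝ) 1,
      Tendsto (fun k => ∫ y in (0 : ℝ)..x, f k y) atTop (𝓝 (∫ y in (0 : ℝ)..x, v y)))
    {η : ℝ} (hη : 0 < η) (hη1 : η ≤ 1) :
    Tendsto (fun k => ∫ x in (0 : ℝ)..(1 - η), |windowAverage (s k) (f k) x - v x|)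
      atTop (𝓝 0) := by
  -- Three comparisons: scale s k with scale h for f k (variation), f k with v at scale h (weak
  -- convergence), scale h with v itself (differentiation).
  have hub : ∀ h, 0 < h → ∀ k, s k + h ≤ η →
      ∫ x in (0 : ℝ)..(1 - η), |windowAverage (s k) (f k) x - v x| ≤
        h * C + 2 * s k / h +
        (∫ x in (0 : ℝ)..(1 - η), |windowAverage h (f k) x - windowAverage h v x|) +
        ∫ x in (0 : ℝ)..(1 - η), |windowAverage h v x - v x| := by
    intro h hh k hk
    have c1 := continuous_windowAverage (hf k) (hfb k) (s k)
    have c2 := continuous_windowAverage (hf k) (hfb k) h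
    have c3 := continuous_windowAverage hv hvb h
    have c4 := continuous_shiftVariation (hf k) (hfb k) (s k)
    have c5 : Continuous fun x => shiftVariation (s k) (f k) (x + h) - shiftVariation (s k) (f k) x :=
      (c4.comp (continuous_add_const h)).sub c4
    have i5 := c5.intervalIntegrable (μ := volume) 0 (1 - η)
    have i0 : IntervalIntegrable (fun _ : ℝ => 2 * s k / h) volume 0 (1 - η) := by simp
    have i1 : IntervalIntegrable (fun x => |windowAverage h (f k) x - windowAverage h v x|) volume
        0 (1 - η) := (c2.sub c3).abs.intervalIntegrable _ _
    have hi2 : ∀ g : ℝ → ℝ, Continuous g →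
        IntervalIntegrable (fun x => |g x - v x|) volume 0 (1 - η) := fun g hg =>
      ((hg.intervalIntegrable _ _).sub (intervalIntegrable_of_bounded hv hvb _ _)).abs
    calc _ ≤ ∫ x in (0 : ℝ)..(1 - η), (((shiftVariation (s k) (f k) (x + h) -
            shiftVariation (s k) (f k) x) + 2 * s k / h +
            |windowAverage h (f k) x - windowAverage h v x|) + |windowAverage h v x - v x|) := by
          refine intervalIntegral.integral_mono_on (by linarith) (hi2 _ c1)
            (((i5.add i0).add i1).add (hi2 _ c3)) fun x _ => ?_
          have h1 := abs_windowAverage_sub_windowAverage_le (hf k) (hfb k) (hs k) hh x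
          have h2 := abs_sub_le (windowAverage (s k) (f k) x) (windowAverage h (f k) x) (v x)
          have h3 := abs_sub_le (windowAverage h (f k) x) (windowAverage h v x) (v x)
          linarith
      _ ≤ _ := by
          rw [intervalIntegral.integral_add ((i5.add i0).add i1) (hi2 _ c3),
            intervalIntegral.integral_add (i5.add i0) i1, intervalIntegral.integral_add i5 i0]
          have h1 := integral_shiftVariation_sub_le (hf k) (hfb k) (hs k) hh hk
          have h2 : h * shiftVariation (s k) (f k) (1 - s k) ≤ h * C := by gcongr; exact hC k
          have h3 : (∫ x in (0 : ℝ)..(1 - η), 2 * s k / h) ≤ 2 * s k / h := by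
            rw [intervalIntegral.integral_const, smul_eq_mul, sub_zero]
            have := hs k
            exact mul_le_of_le_one_left (by positivity) (by linarith)
          linarith
  rw [Metric.tendsto_atTop]
  intro ε hε
  -- First h is fixed, small enough for the terms that persist as k grows; only then is k taken
  -- large.
  have e1 : ∀ᶠ h in 𝓝[>] (0 : ℝ), ∫ x in (0 : ℝ)..(1 - η), |windowAverage h v x - v x| < ε / 4 :=
    (tendsto_integral_windowAverage_sub_self hv hvb 0 (1 - η)).eventually_lt_const (by positivity)
  have e2 : ∀ᶠ h in 𝓝[>] (0 : ℝ), h * C < ε / 4 := by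
    have : Tendsto (fun h : ℝ => h * C) (𝓝[>] 0) (𝓝 (0 * C)) :=
      (continuous_mul_const C).continuousAt.tendsto.mono_left nhdsWithin_le_nhds
    rw [zero_mul] at this
    exact this.eventually_lt_const (by positivity)
  have e3 : ∀ᶠ h in 𝓝[>] (0 : ℝ), h < η / 2 :=
    nhdsWithin_le_nhds (Iio_mem_nhds (by positivity))
  obtain ⟨h, h1, h2, h3, h4⟩ := (e1.and (e2.and (e3.and self_mem_nhdsWithin))).exists
  have hh : 0 < h := h4
  have t1 := (tendsto_integral_windowAverage_sub hf hfb hv hvb hconv hh (by linarith)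
    hη1).eventually_lt_const (show (0 : ℝ) < ε / 4 by positivity)
  have t2 : ∀ᶠ k in atTop, 2 * s k / h < ε / 4 := by
    have : Tendsto (fun k => 2 * s k / h) atTop (𝓝 (2 * 0 / h)) := (hs0.const_mul 2).div_const h
    rw [mul_zero, zero_div] at this
    exact this.eventually_lt_const (by positivity)
  have t3 : ∀ᶠ k in atTop, s k < η / 2 := hs0.eventually_lt_const (by positivity)
  obtain ⟨K, hK⟩ := eventually_atTop.1 (t1.and (t2.and t3))
  refine ⟨K, fun k hk => ?_⟩
  obtain ⟨k1, k2, k3⟩ := hK k hk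
  have := hub h hh k (by linarith)
  rw [Real.dist_eq, sub_zero, abs_of_nonneg (intervalIntegral.integral_nonneg (by linarith)
    fun _ _ => abs_nonneg _)]
  linarith

/-- Where |w - v| < δ, the bounds δ ≤ v ≤ 1 - δ force 0 < w < 1; the exceptional set is controlled
by Markov's inequality. -/
lemma volume_middle_le {v w : ℝ → ℝ} (hv : Measurable v) (hvb : ∀ x, |v x| ≤ 1)
    (hw : Continuous w) {δ s η : ℝ} (hδ : 0 < δ) (hη1 : η ≤ 1) (hsη : s < η) :
    volume.real {x ∈ Ioo 0 (1 - η) | δ ≤ v x ∧ v x ≤ 1 - δ} ≤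
      volume.real {x ∈ Ioo 0 (1 - s) | 0 < w x ∧ w x < 1} +
        (1 / δ) * ∫ x in (0 : ℝ)..(1 - η), |w x - v x| := by
  set A := {x ∈ Ioo 0 (1 - s) | 0 < w x ∧ w x < 1}
  set B := {x ∈ Ioc 0 (1 - η) | δ ≤ |w x - v x|}
  have hsub : {x ∈ Ioo 0 (1 - η) | δ ≤ v x ∧ v x ≤ 1 - δ} ⊆ A ∪ B := by
    rintro x ⟨⟨h1, h2⟩, h3, h4⟩
    by_cases h5 : δ ≤ |w x - v x|
    · exact Or.inr ⟨⟨h1, h2.le⟩, h5⟩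
    · rw [not_le, abs_lt] at h5
      exact Or.inl ⟨⟨h1, by linarith⟩, by linarith [h5.1], by linarith [h5.2]⟩
  have hfinA : volume A ≠ ∞ :=
    measure_ne_top_of_subset (fun x hx => hx.1) (by simp : volume (Ioo 0 (1 - s)) ≠ ∞)
  have hfinB : volume B ≠ ∞ :=
    measure_ne_top_of_subset (fun x hx => hx.1) (by simp : volume (Ioc 0 (1 - η)) ≠ ∞)
  have hB : δ * volume.real B ≤ ∫ x in (0 : ℝ)..(1 - η), |w x - v x| := by
    have hi : IntervalIntegrable (fun x => |w x - v x|) volume 0 (1 - η) :=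
      ((hw.intervalIntegrable _ _).sub (intervalIntegrable_of_bounded hv hvb _ _)).abs
    rw [intervalIntegral.integral_of_le (by linarith)]
    have := mul_meas_ge_le_integral_of_nonneg (Eventually.of_forall fun x => abs_nonneg (w x - v x))
      hi.1 δ
    rw [measureReal_restrict_apply' measurableSet_Ioc] at this
    refine le_trans (le_of_eq ?_) this
    congr 2
    ext x
    simp [B, and_comm]
  calc _ ≤ volume.real (A ∪ B) := measureReal_mono hsub (measure_union_ne_top hfinA hfinB)
    _ ≤ volume.real A + volume.real B := measureReal_union_le _ _
    _ ≤ _ := by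
        gcongr
        rw [one_div, inv_mul_eq_div, le_div_iff₀ hδ]
        linarith

/-! ### Spin configurations as step functions -/

/-- The function on `(0,1]` with value `b i` on the `i`-th of `N` equal cells, extended by zero. -/
def stepFun (N : ℕ) (b : ℕ → ℝ) (x : ℝ) : ℝ :=
  if x ∈ Ioc (0 : ℝ) 1 then b (⌈(N : ℝ) * x⌉₊ - 1) else 0

lemma measurable_stepFun (N : ℕ) (b : ℕ → ℝ) : Measurable (stepFun N b) := by
  refine Measurable.ite measurableSet_Ioc ?_ measurable_const
  exact (measurable_from_nat (f := fun m => b (m - 1))).comp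
    (Nat.measurable_ceil.comp (measurable_const_mul _))

lemma ceil_sub_one_eq {N i : ℕ} (hN : 0 < N) {x : ℝ}
    (hx : x ∈ Ioc ((i : ℝ) / N) (((i : ℝ) + 1) / N)) : ⌈(N : ℝ) * x⌉₊ - 1 = i := by
  have hN' : (0 : ℝ) < N := by exact_mod_cast hN
  have h1 : ⌈(N : ℝ) * x⌉₊ = i + 1 := by
    rw [Nat.ceil_eq_iff (by omega)]
    obtain ⟨h1, h2⟩ := hx
    rw [div_lt_iff₀ hN'] at h1
    rw [le_div_iff₀ hN'] at h2
    push_cast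
    constructor <;> linarith
  omega

lemma mem_cell_of_mem {N : ℕ} (hN : 0 < N) {x : ℝ} (hx : x ∈ Ioc (0 : ℝ) 1) :
    ⌈(N : ℝ) * x⌉₊ - 1 < N ∧ x ∈ Ioc (((⌈(N : ℝ) * x⌉₊ - 1 : ℕ) : ℝ) / N)
      ((((⌈(N : ℝ) * x⌉₊ - 1 : ℕ) : ℝ) + 1) / N) := by
  have hN' : (0 : ℝ) < N := by exact_mod_cast hN
  have h0 : 0 < (N : ℝ) * x := mul_pos hN' hx.1
  have h1 : 0 < ⌈(N : ℝ) * x⌉₊ := Nat.ceil_pos.2 h0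
  have h2 : ⌈(N : ℝ) * x⌉₊ ≤ N := Nat.ceil_le.2 (by nlinarith [hx.2])
  have h3 := Nat.ceil_lt_add_one h0.le
  have h4 := Nat.le_ceil ((N : ℝ) * x)
  refine ⟨by omega, ?_, ?_⟩
  · rw [div_lt_iff₀ hN', Nat.cast_sub h1]; push_cast; linarith
  · rw [le_div_iff₀ hN', Nat.cast_sub h1]; push_cast; linarith

lemma cell_subset {N i : ℕ} (hi : i < N) :
    Ioc ((i : ℝ) / N) (((i : ℝ) + 1) / N) ⊆ Ioc (0 : ℝ) 1 := by
  have hN' : (0 : ℝ) < N := by exact_mod_cast (Nat.zero_le i).trans_lt hi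
  have hi' : (i : ℝ) + 1 ≤ N := by exact_mod_cast hi
  rintro x ⟨h1, h2⟩
  exact ⟨lt_of_le_of_lt (by positivity) h1, h2.trans ((div_le_one hN').2 hi')⟩

lemma stepFun_of_mem_cell {N i : ℕ} (b : ℕ → ℝ) (hi : i < N) {x : ℝ}
    (hx : x ∈ Ioc ((i : ℝ) / N) (((i : ℝ) + 1) / N)) : stepFun N b x = b i := by
  rw [stepFun, if_pos (cell_subset hi hx), ceil_sub_one_eq (by omega) hx]

lemma stepFun_eq_zero_or_one {N : ℕ} {b : ℕ → ℝ} (hN : 0 < N)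
    (hb : ∀ i < N, b i = 0 ∨ b i = 1) (x : ℝ) : stepFun N b x = 0 ∨ stepFun N b x = 1 := by
  rw [stepFun]
  split_ifs with hx
  · exact hb _ (mem_cell_of_mem hN hx).1
  · exact Or.inl rfl

lemma siteValues_eq_zero_or_one {n : ℕ} {v : ℝ → ℝ} (hv : v ∈ spinFunctions n) {i : ℕ}
    (hi : i < n ^ 2) : siteValues n v i = 0 ∨ siteValues n v i = 1 := by
  refine hv.1 _ ⟨?_, ?_⟩
  · have : 0 < (n : ℝ) ^ 2 := by exact_mod_cast (by omega : 0 < n ^ 2)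
    positivity
  · have : 0 < (n : ℝ) ^ 2 := by exact_mod_cast (by omega : 0 < n ^ 2)
    rw [div_le_one this]
    exact_mod_cast hi

lemma spinFunction_eq_stepFun {n : ℕ} (hn : 0 < n) {v : ℝ → ℝ} (hv : v ∈ spinFunctions n) {x : ℝ}
    (hx : x ∈ Ioc (0 : ℝ) 1) : v x = stepFun (n ^ 2) (siteValues n v) x := by
  obtain ⟨h1, h2⟩ := mem_cell_of_mem (N := n ^ 2) (by positivity) hx
  rw [stepFun, if_pos hx]
  set i := ⌈((n ^ 2 : ℕ) : ℝ) * x⌉₊ - 1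
  have hn' : (0 : ℝ) < (n : ℝ) ^ 2 := by positivity
  refine hv.2 (i + 1) (by rw [Finset.mem_Icc]; omega) x ?_ _ ?_
  · push_cast at h2 ⊢
    rwa [add_sub_cancel_right]
  · push_cast
    rw [add_sub_cancel_right]
    exact ⟨by gcongr; linarith, le_rfl⟩

lemma integral_eq_sum_cells {N : ℕ} (g : ℝ → ℝ) (M : ℕ)
    (hg : ∀ a b, IntervalIntegrable g volume a b) :
    ∫ x in (0 : ℝ)..((M : ℝ) / N), g x =
      ∑ i ∈ Finset.range M, ∫ x in ((i : ℝ) / N)..(((i : ℝ) + 1) / N), g x := by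
  have := intervalIntegral.sum_integral_adjacent_intervals (f := g) (μ := volume)
    (a := fun i : ℕ => (i : ℝ) / N) (n := M) fun _ _ => hg _ _
  simp only [Nat.cast_add, Nat.cast_one, Nat.cast_zero, zero_div] at this
  exact this.symm

lemma integral_cell_const {N i : ℕ} (hi : i < N) {g : ℝ → ℝ} {c : ℝ}
    (hg : ∀ x ∈ Ioc ((i : ℝ) / N) (((i : ℝ) + 1) / N), g x = c) :
    ∫ x in ((i : ℝ) / N)..(((i : ℝ) + 1) / N), g x = c / N := by
  have hN' : (0 : ℝ) < N := by exact_mod_cast (Nat.zero_le i).trans_lt hi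
  have h1 : (i : ℝ) / N ≤ ((i : ℝ) + 1) / N := by gcongr; linarith
  rw [intervalIntegral.integral_of_le h1, setIntegral_congr_fun measurableSet_Ioc hg,
    ← intervalIntegral.integral_of_le h1, intervalIntegral.integral_const, smul_eq_mul]
  field_simp
  ring

lemma add_inv_mem_cell {n i : ℕ} (hn : 0 < n) {x : ℝ}
    (hx : x ∈ Ioc ((i : ℝ) / (n ^ 2 : ℕ)) (((i : ℝ) + 1) / (n ^ 2 : ℕ))) :
    x + 1 / n ∈ Ioc (((i + n : ℕ) : ℝ) / (n ^ 2 : ℕ)) ((((i + n : ℕ) : ℝ) + 1) / (n ^ 2 : ℕ)) := by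
  have h1 : (1 : ℝ) / n = (n : ℝ) / (n ^ 2 : ℕ) := by push_cast; field_simp
  rw [h1]
  push_cast at hx ⊢
  rw [add_div, add_right_comm, add_div _ (n : ℝ)]
  exact ⟨by linarith [hx.1], by linarith [hx.2]⟩

lemma one_sub_inv_eq {n : ℕ} (hn : 0 < n) :
    (1 : ℝ) - 1 / n = ((n ^ 2 - n : ℕ) : ℝ) / (n ^ 2 : ℕ) := by
  rw [Nat.cast_sub (by nlinarith)]
  push_cast
  field_simp

lemma abs_le_one_of_zero_or_one {a : ℝ} (h : a = 0 ∨ a = 1) : |a| ≤ 1 := by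
  rcases h with rfl | rfl <;> simp

/-- Translation by 1/n carries each of the n² cells onto the cell n places further, and |a - b| = (a
- b)² for values 0 and 1. -/
lemma shiftVariation_stepFun {n : ℕ} (hn : 0 < n) {b : ℕ → ℝ}
    (hb : ∀ i < n ^ 2, b i = 0 ∨ b i = 1) :
    shiftVariation (1 / n) (stepFun (n ^ 2) b) (1 - 1 / n) = verticalJumps n b / n := by
  have hfb : ∀ x, |stepFun (n ^ 2) b x| ≤ 1 := fun x =>
    abs_le_one_of_zero_or_one (stepFun_eq_zero_or_one (by positivity) hb x)
  rw [shiftVariation, one_sub_inv_eq hn, integral_eq_sum_cells _ _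
    fun a b => intervalIntegrable_shift (measurable_stepFun _ _) hfb _ a b, verticalJumps]
  have h1 : ∀ i ∈ Finset.range (n ^ 2 - n),
      ∫ x in ((i : ℝ) / (n ^ 2 : ℕ))..(((i : ℝ) + 1) / (n ^ 2 : ℕ)),
        |stepFun (n ^ 2) b (x + 1 / n) - stepFun (n ^ 2) b x| =
      (b i - b (i + n)) ^ 2 / (n ^ 2 : ℕ) := by
    intro i hi
    rw [Finset.mem_range] at hi
    refine integral_cell_const (by omega) fun x hx => ?_
    rw [stepFun_of_mem_cell b (by omega) hx,
      stepFun_of_mem_cell b (by omega) (add_inv_mem_cell hn hx)]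
    rcases hb i (by omega) with h | h <;> rcases hb (i + n) (by omega) with h' | h' <;>
      rw [h, h'] <;> norm_num
  rw [Finset.sum_congr rfl h1, ← Finset.sum_div]
  push_cast
  field_simp

/-- If x lies in cell i, then (x, x + 1/n] meets only cells i, …, i + n. When these carry a single
value, the average is 0 or 1, so the set is covered by the cells that start mixed windows. -/
lemma volume_mixed_le {n : ℕ} (hn : 0 < n) {b : ℕ → ℝ}
    (hb : ∀ i < n ^ 2, b i = 0 ∨ b i = 1) :
    volume.real {x ∈ Ioo (0 : ℝ) (1 - 1 / n) | 0 < windowAverage (1 / n) (stepFun (n ^ 2) b) x ∧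
      windowAverage (1 / n) (stepFun (n ^ 2) b) x < 1} ≤
      (mixedWindows n b).card / (n : ℝ) ^ 2 := by
  have hN : 0 < n ^ 2 := by positivity
  have hN' : (0 : ℝ) < (n ^ 2 : ℕ) := by exact_mod_cast hN
  have hsub : {x ∈ Ioo (0 : ℝ) (1 - 1 / n) |
      0 < windowAverage (1 / n) (stepFun (n ^ 2) b) x ∧
      windowAverage (1 / n) (stepFun (n ^ 2) b) x < 1} ⊆
      ⋃ i ∈ mixedWindows n b, Ioc ((i : ℝ) / (n ^ 2 : ℕ)) (((i : ℝ) + 1) / (n ^ 2 : ℕ)) := by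
    rintro x ⟨⟨h1, h2⟩, h3⟩
    have hn0 : (0 : ℝ) < 1 / n := by positivity
    obtain ⟨h4, h5⟩ := mem_cell_of_mem hN (x := x) ⟨h1, by linarith⟩
    set i := ⌈((n ^ 2 : ℕ) : ℝ) * x⌉₊ - 1
    have h6 : i < n ^ 2 - n := by
      have := h5.1.trans h2
      rw [one_sub_inv_eq hn] at this
      rw [div_lt_div_iff_of_pos_right hN'] at this
      exact_mod_cast this
    refine mem_iUnion₂.2 ⟨i, ?_, h5⟩
    classical
    rw [mixedWindows, Finset.mem_filter]
    refine ⟨Finset.mem_range.2 h6, ?_⟩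
    by_contra! hcon
    have h7 : windowAverage (1 / n) (stepFun (n ^ 2) b) x = b i := by
      have h8 : ∀ y ∈ Ioc x (x + 1 / n), stepFun (n ^ 2) b y = b i := by
        intro y hy
        have hx1 := add_inv_mem_cell hn h5
        obtain ⟨h9, h10⟩ := mem_cell_of_mem hN (x := y)
          ⟨h1.trans hy.1, hy.2.trans (by linarith)⟩
        rw [stepFun, if_pos ⟨h1.trans hy.1, hy.2.trans (by linarith)⟩]
        set j := ⌈((n ^ 2 : ℕ) : ℝ) * y⌉₊ - 1
        refine hcon j (Finset.mem_Icc.2 ⟨?_, ?_⟩)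
        · have h11 := h5.1.trans (hy.1.trans_le h10.2)
          rw [div_lt_div_iff_of_pos_right hN'] at h11
          have : i < j + 1 := by exact_mod_cast h11
          omega
        · have h11 := h10.1.trans_le (hy.2.trans hx1.2)
          rw [div_lt_div_iff_of_pos_right hN'] at h11
          have : j < i + n + 1 := by exact_mod_cast h11
          omega
      rw [windowAverage, intervalIntegral.integral_of_le (by linarith),
        setIntegral_congr_fun measurableSet_Ioc h8,
        ← intervalIntegral.integral_of_le (by linarith), intervalIntegral.integral_const]
      simp
      field_simp
    rw [h7] at h3
    rcases hb i h4 with h | h <;> rw [h] at h3 <;> linarith [h3.1, h3.2]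
  have hfin : volume (⋃ i ∈ mixedWindows n b,
      Ioc ((i : ℝ) / (n ^ 2 : ℕ)) (((i : ℝ) + 1) / (n ^ 2 : ℕ))) ≠ ∞ :=
    ((measure_biUnion_finset_le _ _).trans_lt (ENNReal.sum_lt_top.2 fun i _ => by simp)).ne
  calc _ ≤ volume.real (⋃ i ∈ mixedWindows n b,
        Ioc ((i : ℝ) / (n ^ 2 : ℕ)) (((i : ℝ) + 1) / (n ^ 2 : ℕ))) := measureReal_mono hsub hfin
    _ ≤ ∑ i ∈ mixedWindows n b,
        volume.real (Ioc ((i : ℝ) / (n ^ 2 : ℕ)) (((i : ℝ) + 1) / (n ^ 2 : ℕ))) :=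
      measureReal_biUnion_finset_le _ _
    _ = ∑ i ∈ mixedWindows n b, 1 / (n : ℝ) ^ 2 := by
      refine Finset.sum_congr rfl fun i _ => ?_
      rw [Real.volume_real_Ioc_of_le (by gcongr; linarith)]
      push_cast
      ring
    _ = _ := by rw [Finset.sum_const, nsmul_eq_mul, mul_one_div]

/-! ### Variation tested by difference quotients -/

/-- Discrete integration by parts. As φ vanishes on the nonpositive axis and from 1 - s onwards, the
translation moves to f without boundary terms. -/
lemma integral_translate_test_le {f φ : ℝ → ℝ} (hf : Measurable f) (hfb : ∀ x, |f x| ≤ 1)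
    (hφ : Continuous φ) (hφb : ∀ x, |φ x| ≤ 1) {s : ℝ} (hs : 0 < s) (hs1 : s ≤ 1)
    (h0 : ∀ x ≤ 0, φ x = 0) (h1 : ∀ x, 1 - s ≤ x → φ x = 0) :
    ∫ x in (0 : ℝ)..1, f x * ((φ x - φ (x - s)) / s) ≤ shiftVariation s f (1 - s) := by
  have hi : ∀ (ψ : ℝ → ℝ), Continuous ψ → (∀ x, |ψ x| ≤ 1) → ∀ (t a b : ℝ),
      IntervalIntegrable (fun x => f (x + t) * ψ x) volume a b := by
    intro ψ hψ hψb t a b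
    refine intervalIntegrable_of_bounded (K := 1)
      ((hf.comp (measurable_id.add_const t)).mul hψ.measurable) (fun x => ?_) a b
    change |f (x + t) * ψ x| ≤ 1
    rw [abs_mul]
    exact mul_le_one₀ (hfb _) (abs_nonneg _) (hψb x)
  have hi0 : ∀ a b, IntervalIntegrable (fun x => f x * φ x) volume a b := by
    simpa using hi φ hφ hφb 0
  have hφs : Continuous fun x => φ (x - s) := hφ.comp (continuous_sub_right s)
  have hi1 : ∀ a b, IntervalIntegrable (fun x => f x * φ (x - s)) volume a b := by
    simpa using hi _ hφs (fun x => hφb _) 0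
  have e1 : ∫ x in (0 : ℝ)..1, f x * ((φ x - φ (x - s)) / s) =
      (1 / s) * ((∫ x in (0 : ℝ)..1, f x * φ x) - ∫ x in (0 : ℝ)..1, f x * φ (x - s)) := by
    rw [← intervalIntegral.integral_sub (hi0 _ _) (hi1 _ _),
      ← intervalIntegral.integral_const_mul]
    congr 1
    funext x
    field_simp
  have e2 : ∫ x in (0 : ℝ)..1, f x * φ (x - s) = ∫ x in (0 : ℝ)..(1 - s), f (x + s) * φ x := by
    have h2 := intervalIntegral.integral_comp_sub_right (a := 0) (b := 1)
      (fun x => f (x + s) * φ x) s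
    simp only [sub_add_cancel, zero_sub] at h2
    rw [h2, ← intervalIntegral.integral_add_adjacent_intervals (b := 0) (hi φ hφ hφb s _ _)
      (hi φ hφ hφb s _ _), intervalIntegral.integral_zero_ae, zero_add]
    refine Eventually.of_forall fun x hx => ?_
    rw [uIoc_of_le (by linarith)] at hx
    rw [h0 x hx.2, mul_zero]
  have e3 : ∫ x in (0 : ℝ)..1, f x * φ x = ∫ x in (0 : ℝ)..(1 - s), f x * φ x := by
    rw [← intervalIntegral.integral_add_adjacent_intervals (b := 1 - s) (hi0 _ _) (hi0 _ _),
      intervalIntegral.integral_zero_ae (a := 1 - s), add_zero]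
    refine Eventually.of_forall fun x hx => ?_
    rw [uIoc_of_le (by linarith)] at hx
    rw [h1 x hx.1.le, mul_zero]
  rw [e1, e2, e3, shiftVariation, ← intervalIntegral.integral_sub (hi0 _ _) (hi φ hφ hφb s _ _)]
  gcongr
  refine intervalIntegral.integral_mono_on (by linarith) ((hi0 _ _).sub (hi φ hφ hφb s _ _))
    (intervalIntegrable_shift hf hfb s _ _) fun x _ => ?_
  calc f x * φ x - f (x + s) * φ x = (f x - f (x + s)) * φ x := by ring
    _ ≤ |f x - f (x + s)| * |φ x| := by rw [← abs_mul]; exact le_abs_self _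
    _ ≤ |f x - f (x + s)| * 1 := by gcongr; exact hφb x
    _ = _ := by rw [mul_one, abs_sub_comm]

lemma integral_leb01 (g : ℝ → ℝ) : ∫ x, g x ∂leb01 = ∫ x in (0 : ℝ)..1, g x := by
  rw [intervalIntegral.integral_of_le zero_le_one, integral_Ioc_eq_integral_Ioo]

lemma test_eq_zero_near_one {φ : ℝ → ℝ} (hφ : φ ∈ testFunctions) :
    ∃ ε > 0, ∀ x, 1 - ε ≤ x → φ x = 0 := by
  obtain ⟨-, hφc, hφs, -⟩ := hφ
  rcases (tsupport φ).eq_empty_or_nonempty with h | h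
  · exact ⟨1, one_pos, fun x _ => image_eq_zero_of_notMem_tsupport (by simp [h])⟩
  · obtain ⟨m, hm, hmax⟩ := hφc.exists_isGreatest h
    refine ⟨(1 - m) / 2, by linarith [(hφs hm).2], fun x hx => ?_⟩
    refine image_eq_zero_of_notMem_tsupport fun hx' => ?_
    linarith [hmax hx', (hφs hm).2]

lemma test_eq_zero_of_nonpos {φ : ℝ → ℝ} (hφ : φ ∈ testFunctions) {x : ℝ} (hx : x ≤ 0) :
    φ x = 0 :=
  image_eq_zero_of_notMem_tsupport fun h => absurd (hφ.2.2.1 h).1 (not_lt.2 hx)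

lemma continuous_deriv_test {φ : ℝ → ℝ} (hφ : φ ∈ testFunctions) : Continuous (deriv φ) :=
  hφ.1.continuous_deriv le_rfl

lemma integrable_deriv_test {φ : ℝ → ℝ} (hφ : φ ∈ testFunctions) :
    Integrable (deriv φ) leb01 :=
  ((continuous_deriv_test hφ).integrable_of_hasCompactSupport hφ.2.1.deriv).restrict

lemma tendsto_integral_difference_quotient {φ : ℝ → ℝ} (hφ : φ ∈ testFunctions) {s : ℕ → ℝ}
    (hs : ∀ k, 0 < s k) (hs0 : Tendsto s atTop (𝓝 0)) :
    Tendsto (fun k => ∫ x in (0 : ℝ)..1, |(φ x - φ (x - s k)) / s k - deriv φ x|) atTop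
      (𝓝 0) := by
  obtain ⟨K, hK⟩ := hφ.1.lipschitzWith_of_hasCompactSupport hφ.2.1 one_ne_zero
  have h0 : (0 : ℝ) = ∫ x in (0 : ℝ)..1, (0 : ℝ) := by simp
  have hc := hφ.1.continuous
  conv => rhs; rw [h0]
  refine intervalIntegral.tendsto_integral_filter_of_dominated_convergence (fun _ => 2 * K) ?_ ?_
    (by simp) ?_
  · refine Eventually.of_forall fun k => Continuous.aestronglyMeasurable ?_
    exact (((hc.sub (hc.comp (continuous_sub_right (s k)))).div_const _).sub
      (continuous_deriv_test hφ)).abs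
  · refine Eventually.of_forall fun k => Eventually.of_forall fun x _ => ?_
    have h1 : ‖deriv φ x‖ ≤ K := norm_deriv_le_of_lipschitz hK
    have h2 : |(φ x - φ (x - s k)) / s k| ≤ K := by
      rw [abs_div, abs_of_pos (hs k), div_le_iff₀ (hs k)]
      have := hK.dist_le_mul x (x - s k)
      rwa [Real.dist_eq, Real.dist_eq, sub_sub_cancel, abs_of_pos (hs k)] at this
    rw [Real.norm_eq_abs, abs_abs]
    rw [Real.norm_eq_abs] at h1
    linarith [abs_sub ((φ x - φ (x - s k)) / s k) (deriv φ x)]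
  · refine Eventually.of_forall fun x _ => ?_
    have h1 : HasDerivAt φ (deriv φ x) x := (hφ.1.differentiable one_ne_zero x).hasDerivAt
    have h2 := h1.tendsto_slope_zero_left
    have h3 : Tendsto (fun k => -s k) atTop (𝓝[<] 0) := by
      refine tendsto_nhdsWithin_iff.2 ⟨by simpa using hs0.neg, Eventually.of_forall fun k => ?_⟩
      simpa using hs k
    have h4 := ((h2.comp h3).sub_const (deriv φ x)).abs
    rw [sub_self, abs_zero] at h4
    refine h4.congr fun k => ?_
    have := (hs k).ne'
    simp only [Function.comp, smul_eq_mul]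
    congr 2
    rw [← sub_eq_add_neg, inv_neg]
    field_simp
    ring

/-- The difference quotients of φ converge in L¹ to its derivative and f k is bounded, so the
convergence of the integrals against `deriv φ` suffices. -/
lemma tendsto_integral_translate_test {f : ℕ → ℝ → ℝ} {v φ : ℝ → ℝ} {s : ℕ → ℝ}
    (hf : ∀ k, Measurable (f k)) (hfb : ∀ k x, |f k x| ≤ 1) (hφ : φ ∈ testFunctions)
    (hs : ∀ k, 0 < s k) (hs0 : Tendsto s atTop (𝓝 0))
    (hconv : Tendsto (fun k => ∫ x in (0 : ℝ)..1, f k x * deriv φ x) atTop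
      (𝓝 (∫ x in (0 : ℝ)..1, v x * deriv φ x))) :
    Tendsto (fun k => ∫ x in (0 : ℝ)..1, f k x * ((φ x - φ (x - s k)) / s k)) atTop
      (𝓝 (∫ x in (0 : ℝ)..1, v x * deriv φ x)) := by
  have h1 : Tendsto (fun k => ∫ x in (0 : ℝ)..1,
      f k x * ((φ x - φ (x - s k)) / s k - deriv φ x)) atTop (𝓝 0) := by
    refine squeeze_zero_norm (fun k => ?_) (tendsto_integral_difference_quotient hφ hs hs0)
    refine intervalIntegral.norm_integral_le_of_norm_le zero_le_one
      (Eventually.of_forall fun x _ => ?_) (Continuous.intervalIntegrable ?_ _ _)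
    · rw [norm_mul, Real.norm_eq_abs, Real.norm_eq_abs]
      exact mul_le_of_le_one_left (abs_nonneg _) (hfb k x)
    · exact (((hφ.1.continuous.sub (hφ.1.continuous.comp (continuous_sub_right (s k)))).div_const
        _).sub (continuous_deriv_test hφ)).abs
  have h2 := h1.add hconv
  rw [zero_add] at h2
  refine h2.congr fun k => ?_
  have hi : ∀ ψ : ℝ → ℝ, Continuous ψ →
      IntervalIntegrable (fun x => f k x * ψ x) volume 0 1 := fun ψ hψ =>
    (intervalIntegrable_of_bounded (hf k) (hfb k) 0 1).mul_continuousOn hψ.continuousOn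
  rw [← intervalIntegral.integral_add (hi _ ?_) (hi _ (continuous_deriv_test hφ))]
  · congr 1
    funext x
    ring
  · exact ((hφ.1.continuous.sub (hφ.1.continuous.comp (continuous_sub_right (s k)))).div_const
        _).sub (continuous_deriv_test hφ)

lemma zero_mem_testFunctions : (fun _ : ℝ => (0 : ℝ)) ∈ testFunctions :=
  ⟨contDiff_const, HasCompactSupport.zero, by simp [tsupport], by simp⟩

/-! ### Pointwise bounds for weak-* limits -/

lemma integrable_Linf_mul (u : Linf01) {g : ℝ → ℝ} (hg : Integrable g leb01) :
    Integrable (fun x => u x * g x) leb01 := by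
  have := hg.mul_of_top_right (Lp.memLp u)
  exact this

lemma integrable_Linf (u : Linf01) : Integrable u leb01 := (Lp.memLp u).integrable le_top

lemma integral_mul_indicator {S : Set ℝ} (hS : MeasurableSet S) (w : ℝ → ℝ) :
    ∫ x, w x * S.indicator (fun _ => (1 : ℝ)) x ∂leb01 = ∫ x in S, w x ∂leb01 := by
  rw [← integral_indicator hS]
  congr 1
  funext x
  by_cases hx : x ∈ S <;> simp [hx]

lemma WeakStarConv.tendsto_setIntegral {y : ℕ → Linf01} {v : Linf01} (h : WeakStarConv y v)
    {S : Set ℝ} (hS : MeasurableSet S) :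
    Tendsto (fun k => ∫ x in S, y k x ∂leb01) atTop (𝓝 (∫ x in S, v x ∂leb01)) := by
  have h1 := h (S.indicator fun _ => 1) ((integrable_const (1 : ℝ)).indicator hS)
  simpa only [integral_mul_indicator hS] using h1

lemma ae_mem_Icc_of_tendsto_setIntegral {y : ℕ → ℝ → ℝ} {v : ℝ → ℝ}
    (hyi : ∀ k, Integrable (y k) leb01) (hvi : Integrable v leb01)
    (h : ∀ S, MeasurableSet S →
      Tendsto (fun k => ∫ x in S, y k x ∂leb01) atTop (𝓝 (∫ x in S, v x ∂leb01)))
    (hy : ∀ k, ∀ᵐ x ∂leb01, 0 ≤ y k x ∧ y k x ≤ 1) : ∀ᵐ x ∂leb01, 0 ≤ v x ∧ v x ≤ 1 := by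
  have h1 : 0 ≤ᵐ[leb01] v := by
    refine ae_nonneg_of_forall_setIntegral_nonneg hvi fun S hS _ => ?_
    refine ge_of_tendsto' (h S hS) fun k => ?_
    exact setIntegral_nonneg_of_ae ((hy k).mono fun x hx => hx.1)
  have h2 : 0 ≤ᵐ[leb01] fun x => 1 - v x := by
    refine ae_nonneg_of_forall_setIntegral_nonneg ((integrable_const 1).sub hvi) fun S hS _ => ?_
    rw [integral_sub (integrable_const 1) hvi.integrableOn]
    refine ge_of_tendsto' ((h S hS).const_sub _) fun k => ?_
    rw [← integral_sub (integrable_const 1) (hyi k).integrableOn]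
    refine setIntegral_nonneg_of_ae ((hy k).mono fun x hx => ?_)
    exact sub_nonneg.2 hx.2
  filter_upwards [h1, h2] with x a b
  exact ⟨a, sub_nonneg.1 b⟩

lemma WeakStarConv.ae_mem_Icc {y : ℕ → Linf01} {v : Linf01} (h : WeakStarConv y v)
    (hy : ∀ k, ∀ᵐ x ∂leb01, 0 ≤ y k x ∧ y k x ≤ 1) : ∀ᵐ x ∂leb01, 0 ≤ v x ∧ v x ≤ 1 :=
  ae_mem_Icc_of_tendsto_setIntegral (fun k => integrable_Linf (y k)) (integrable_Linf v)
    (fun _ hS => h.tendsto_setIntegral hS) hy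

/-! ### The liminf inequality -/

/-- The vertical jumps are used twice: on their own, and through V/n ≤ c to turn the correction
2V/n² of the window count into 2c/n. -/
lemma mixed_add_vertical_le {n : ℕ} (hn : 0 < n) {b : ℕ → ℝ} {c : ℝ}
    (hb : ∀ i < n ^ 2, b i = 0 ∨ b i = 1)
    (hE : (1 / (n : ℝ)) * (horizontalJumps n b + verticalJumps n b) ≤ c) :
    2 * volume.real {x ∈ Ioo (0 : ℝ) (1 - 1 / n) |
      0 < windowAverage (1 / n) (stepFun (n ^ 2) b) x ∧
      windowAverage (1 / n) (stepFun (n ^ 2) b) x < 1} + verticalJumps n b / n ≤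
      c + 2 * c * (1 / n) ∧ verticalJumps n b / n ≤ c := by
  have h1 := volume_mixed_le hn hb
  have h2 := card_mixedWindows_le hb
  have hn' : (0 : ℝ) < n := by exact_mod_cast hn
  have hH := horizontalJumps_nonneg n b
  have hV := verticalJumps_nonneg n b
  have h3 : verticalJumps n b / n ≤ c := by
    refine le_trans ?_ hE
    rw [one_div, inv_mul_eq_div]
    gcongr
    linarith
  refine ⟨?_, h3⟩
  have h4 : 2 * ((mixedWindows n b).card / (n : ℝ) ^ 2) ≤
      horizontalJumps n b / n + 2 * (verticalJumps n b / n) * (1 / n) := by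
    have : 2 * ((mixedWindows n b).card / (n : ℝ) ^ 2) ≤
        (n * horizontalJumps n b + 2 * verticalJumps n b) / (n : ℝ) ^ 2 := by
      rw [← mul_div_assoc]
      gcongr
      linarith
    refine this.trans (le_of_eq ?_)
    field_simp
  have h5 : 2 * (verticalJumps n b / n) * (1 / n) ≤ 2 * c * (1 / n) := by gcongr
  have h6 : (1 / (n : ℝ)) * (horizontalJumps n b + verticalJumps n b) =
      horizontalJumps n b / n + verticalJumps n b / n := by ring
  linarith

/-- Both limit terms are bounded along the same sequence, one paid by horizontal and the other by
vertical bonds, so their sum is bounded by c. The level δ serves also as the margin cut off at the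
right end. -/
lemma volume_middle_add_le {n : ℕ → ℕ} (hn0 : ∀ k, 0 < n k) (hn : Tendsto n atTop atTop)
    {b : ℕ → ℕ → ℝ} {c : ℝ} (hb : ∀ k, ∀ i < n k ^ 2, b k i = 0 ∨ b k i = 1)
    (hE : ∀ k, (1 / (n k : ℝ)) * (horizontalJumps (n k) (b k) + verticalJumps (n k) (b k)) ≤ c)
    {v : ℝ → ℝ} (hv : Measurable v) (hvb : ∀ x, |v x| ≤ 1)
    (hconv : ∀ g : ℝ → ℝ, Integrable g leb01 →
      Tendsto (fun k => ∫ x, stepFun (n k ^ 2) (b k) x * g x ∂leb01) atTop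
        (𝓝 (∫ x, v x * g x ∂leb01)))
    {φ : ℝ → ℝ} (hφ : φ ∈ testFunctions) {δ : ℝ} (hδ : 0 < δ) (hδ1 : δ ≤ 1) :
    2 * volume.real {x ∈ Ioo 0 (1 - δ) | δ ≤ v x ∧ v x ≤ 1 - δ} +
      ∫ x in (0 : ℝ)..1, v x * deriv φ x ≤ c := by
  set f : ℕ → ℝ → ℝ := fun k => stepFun (n k ^ 2) (b k)
  set s : ℕ → ℝ := fun k => 1 / (n k : ℝ)
  have hf : ∀ k, Measurable (f k) := fun k => measurable_stepFun _ _
  have hfb : ∀ k x, |f k x| ≤ 1 := fun k x => abs_le_one_of_zero_or_one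
    (stepFun_eq_zero_or_one (by have := hn0 k; positivity) (hb k) x)
  have hs : ∀ k, 0 < s k := fun k => by have := hn0 k; positivity
  have hs1 : ∀ k, s k ≤ 1 := fun k => by
    have : (1 : ℝ) ≤ n k := by exact_mod_cast hn0 k
    exact (div_le_one (by linarith)).2 this
  have hs0 : Tendsto s atTop (𝓝 0) := tendsto_one_div_atTop_nhds_zero_nat.comp hn
  have hsv : ∀ k, shiftVariation (s k) (f k) (1 - s k) = verticalJumps (n k) (b k) / n k :=
    fun k => shiftVariation_stepFun (hn0 k) (hb k)
  have hmv := fun k => mixed_add_vertical_le (hn0 k) (hb k) (hE k)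
  have hprim : ∀ x ∈ Icc (0 : ℝ) 1,
      Tendsto (fun k => ∫ y in (0 : ℝ)..x, f k y) atTop (𝓝 (∫ y in (0 : ℝ)..x, v y)) := by
    intro x hx
    have h1 := hconv ((Ioc 0 x).indicator fun _ => 1)
      ((integrable_const (1 : ℝ)).indicator measurableSet_Ioc)
    have h2 : ∀ w : ℝ → ℝ, ∫ y, w y * (Ioc 0 x).indicator (fun _ => (1 : ℝ)) y ∂leb01 =
        ∫ y in (0 : ℝ)..x, w y := by
      intro w
      have h3 : (fun y => w y * (Ioc 0 x).indicator (fun _ => (1 : ℝ)) y) =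
          (Ioc 0 x).indicator w := by
        funext y
        by_cases hy : y ∈ Ioc 0 x <;> simp [hy]
      rw [h3, leb01, Measure.restrict_congr_set Ioo_ae_eq_Ioc, setIntegral_indicator measurableSet_Ioc,
        intervalIntegral.integral_of_le hx.1, inter_eq_right.2 (Ioc_subset_Ioc_right hx.2)]
    simpa only [h2] using h1
  have t1 := tendsto_integral_windowAverage hf hfb hv hvb hs hs0
    (fun k => (hsv k).le.trans (hmv k).2) hprim hδ hδ1
  have t2 := tendsto_integral_translate_test hf hfb hφ hs hs0
    (by simpa only [integral_leb01] using hconv _ (integrable_deriv_test hφ))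
  obtain ⟨ε, hε, hεφ⟩ := test_eq_zero_near_one hφ
  have t3 : Tendsto (fun k => 2 * volume.real {x ∈ Ioo 0 (1 - δ) | δ ≤ v x ∧ v x ≤ 1 - δ} -
      2 * ((1 / δ) * ∫ x in (0 : ℝ)..(1 - δ), |windowAverage (s k) (f k) x - v x|) +
      ∫ x in (0 : ℝ)..1, f k x * ((φ x - φ (x - s k)) / s k)) atTop
      (𝓝 (2 * volume.real {x ∈ Ioo 0 (1 - δ) | δ ≤ v x ∧ v x ≤ 1 - δ} - 2 * ((1 / δ) * 0) +
        ∫ x in (0 : ℝ)..1, v x * deriv φ x)) :=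
    (((t1.const_mul (1 / δ)).const_mul 2).const_sub _).add t2
  have t4 : Tendsto (fun k => c + 2 * c * s k) atTop (𝓝 (c + 2 * c * 0)) :=
    (hs0.const_mul (2 * c)).const_add c
  simp only [mul_zero, sub_zero, add_zero] at t3 t4
  refine le_of_tendsto_of_tendsto t3 t4 ?_
  filter_upwards [hs0.eventually_lt_const hδ, hs0.eventually_lt_const hε] with k k1 k2
  have h1 := volume_middle_le hv hvb (continuous_windowAverage (hf k) (hfb k) (s k)) hδ hδ1 k1
  have h2 := integral_translate_test_le (hf k) (hfb k) hφ.1.continuous hφ.2.2.2 (hs k) (hs1 k)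
    (fun x hx => test_eq_zero_of_nonpos hφ hx) fun x hx => hεφ x (by linarith)
  have h3 := (hmv k).1
  rw [hsv k] at h2
  change 2 * volume.real {x ∈ Ioo (0 : ℝ) (1 - s k) | 0 < windowAverage (s k) (f k) x ∧
    windowAverage (s k) (f k) x < 1} + _ ≤ c + 2 * c * s k at h3
  linarith

/-- Let δ = 1/(m + 1) tend to 0: the sets increase to {0 < v < 1}. -/
lemma volume_mixed_add_le {v : ℝ → ℝ} {c r : ℝ}
    (h : ∀ δ, 0 < δ → δ ≤ 1 →
      2 * volume.real {x ∈ Ioo 0 (1 - δ) | δ ≤ v x ∧ v x ≤ 1 - δ} + r ≤ c) :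
    2 * volume.real {x ∈ Ioo (0 : ℝ) 1 | 0 < v x ∧ v x < 1} + r ≤ c := by
  set d : ℕ → ℝ := fun m => 1 / ((m : ℝ) + 1)
  have hd : ∀ m, 0 < d m := fun m => by positivity
  have hd1 : ∀ m, d m ≤ 1 := fun m => (div_le_one (by positivity)).2 (by simp)
  have hanti : Antitone d := fun a b hab => by
    simp only [d]; gcongr
  set S : ℕ → Set ℝ := fun m => {x ∈ Ioo 0 (1 - d m) | d m ≤ v x ∧ v x ≤ 1 - d m}
  have hmono : Monotone S := by
    rintro a b hab x ⟨⟨h1, h2⟩, h3, h4⟩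
    have := hanti hab
    exact ⟨⟨h1, by linarith⟩, by linarith, by linarith⟩
  have hU : ⋃ m, S m = {x ∈ Ioo (0 : ℝ) 1 | 0 < v x ∧ v x < 1} := by
    ext x
    simp only [mem_iUnion]
    constructor
    · rintro ⟨m, ⟨h1, h2⟩, h3, h4⟩
      have := hd m
      exact ⟨⟨h1, by linarith⟩, by linarith, by linarith⟩
    · rintro ⟨⟨h1, h2⟩, h3, h4⟩
      have hd0 : Tendsto d atTop (𝓝 0) := tendsto_one_div_add_atTop_nhds_zero_nat
      obtain ⟨m, m1, m2, m3⟩ := ((hd0.eventually_lt_const (sub_pos.2 h2)).and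
        ((hd0.eventually_lt_const h3).and (hd0.eventually_lt_const (sub_pos.2 h4)))).exists
      exact ⟨m, ⟨h1, by linarith⟩, by linarith, by linarith⟩
  have ht : Tendsto (fun m => volume.real (S m)) atTop
      (𝓝 (volume.real {x ∈ Ioo (0 : ℝ) 1 | 0 < v x ∧ v x < 1})) := by
    rw [← hU]
    refine (ENNReal.tendsto_toReal ?_).comp (tendsto_measure_iUnion_atTop hmono)
    rw [hU]
    exact measure_ne_top_of_subset (fun x hx => hx.1) (by simp : volume (Ioo (0 : ℝ) 1) ≠ ∞)
  exact le_of_tendsto' ((ht.const_mul 2).add_const r) fun m => h _ (hd m) (hd1 m)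

lemma limitFunctional_le_of_forall_test {v : Linf01} {c : ℝ}
    (h01 : ∀ᵐ x ∂leb01, 0 ≤ v x ∧ v x ≤ 1)
    (h : ∀ φ ∈ testFunctions, 2 * volume.real {x ∈ Ioo (0 : ℝ) 1 | 0 < v x ∧ v x < 1} +
      ∫ x in (0 : ℝ)..1, v x * deriv φ x ≤ c) :
    limitFunctional v ≤ ENNReal.ofReal c := by
  set m := volume.real {x ∈ Ioo (0 : ℝ) 1 | 0 < v x ∧ v x < 1}
  -- The zero test function shows c - 2m ≥ 0, so that `ENNReal.ofReal` truncates nothing when the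
  -- two parts are added.
  have hm : 2 * m ≤ c := by simpa using h _ zero_mem_testFunctions
  have hm0 : 0 ≤ m := measureReal_nonneg
  have hvol : volume {x ∈ Ioo (0 : ℝ) 1 | 0 < v x ∧ v x < 1} = ENNReal.ofReal m :=
    (ofReal_measureReal (measure_ne_top_of_subset (fun x hx => hx.1)
      (by simp : volume (Ioo (0 : ℝ) 1) ≠ ∞))).symm
  have hTV : totalVar v ≤ ENNReal.ofReal (c - 2 * m) := by
    refine iSup₂_le fun φ hφ => ENNReal.ofReal_le_ofReal ?_
    rw [integral_leb01]
    linarith [h φ hφ]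
  rw [limitFunctional, if_pos ⟨⟨integrable_Linf v, hTV.trans_lt ENNReal.ofReal_lt_top⟩, h01⟩, hvol]
  calc _ ≤ 2 * ENNReal.ofReal m + ENNReal.ofReal (c - 2 * m) := by gcongr
    _ = ENNReal.ofReal c := by
      rw [show (2 : ℝ≥0∞) = ENNReal.ofReal 2 by simp, ← ENNReal.ofReal_mul (by norm_num),
        ← ENNReal.ofReal_add (by positivity) (by linarith)]
      congr 1
      ring

lemma discreteFunctional_lt_iff {n : ℕ} {u : Linf01} {c : ℝ≥0∞} :
    discreteFunctional n u < c ↔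
      ∃ v ∈ spinFunctions n, u =ᵐ[leb01] v ∧ ENNReal.ofReal (spinEnergy n v) < c := by
  simp only [discreteFunctional, iInf_lt_iff, exists_prop]

lemma ae_eq_stepFun {n : ℕ} (hn : 0 < n) {u : Linf01} {w : ℝ → ℝ} (hw : w ∈ spinFunctions n)
    (hu : u =ᵐ[leb01] w) : u =ᵐ[leb01] stepFun (n ^ 2) (siteValues n w) := by
  filter_upwards [hu, ae_restrict_mem measurableSet_Ioo] with x hx hx'
  rw [hx, spinFunction_eq_stepFun hn hw (Ioo_subset_Ioc_self hx')]

lemma ae_mem_Icc_of_discreteFunctional_lt_top {n : ℕ} (hn : 0 < n) {u : Linf01}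
    (hu : discreteFunctional n u < ∞) : ∀ᵐ x ∂leb01, 0 ≤ u x ∧ u x ≤ 1 := by
  obtain ⟨w, hw, huw, -⟩ := discreteFunctional_lt_iff.1 hu
  filter_upwards [ae_eq_stepFun hn hw huw] with x hx
  rw [hx]
  rcases stepFun_eq_zero_or_one (by positivity : 0 < n ^ 2)
    (fun i hi => siteValues_eq_zero_or_one hw hi) x with h | h <;> rw [h] <;> norm_num

lemma volume_between_congr {u v : ℝ → ℝ} (h : u =ᵐ[leb01] v) :
    volume {x ∈ Ioo (0 : ℝ) 1 | 0 < u x ∧ u x < 1} =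
      volume {x ∈ Ioo (0 : ℝ) 1 | 0 < v x ∧ v x < 1} := by
  refine measure_congr ?_
  filter_upwards [(ae_restrict_iff' measurableSet_Ioo).1 h] with x hx
  apply propext
  change (x ∈ Ioo (0 : ℝ) 1 ∧ _) ↔ (x ∈ Ioo (0 : ℝ) 1 ∧ _)
  refine and_congr_right fun hx' => ?_
  rw [hx hx']

/-- The lower bound, along sequences of bounded energy. -/
lemma limitFunctional_le_of_tendsto {n : ℕ → ℕ} (hn2 : ∀ k, 2 ≤ n k)
    (hn : Tendsto n atTop atTop) {y : ℕ → Linf01} {v : Linf01} (hconv : WeakStarConv y v)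
    {c : ℝ≥0} (hc : ∀ k, discreteFunctional (n k) (y k) < c) :
    limitFunctional v ≤ c := by
  have hn0 : ∀ k, 0 < n k := fun k => by have := hn2 k; omega
  choose w hw hyw hwc using fun k => discreteFunctional_lt_iff.1 (hc k)
  have h01 := hconv.ae_mem_Icc fun k =>
    ae_mem_Icc_of_discreteFunctional_lt_top (hn0 k) ((hc k).trans ENNReal.coe_lt_top)
  -- Clipping gives a measurable representative bounded everywhere, as the averaging estimates
  -- require.
  set v₀ : ℝ → ℝ := fun x => max 0 (min 1 (v x))
  have hv₀ : Measurable v₀ :=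
    measurable_const.max (measurable_const.min (Lp.stronglyMeasurable v).measurable)
  have hv₀b : ∀ x, |v₀ x| ≤ 1 := fun x => by
    rw [abs_of_nonneg (le_max_left _ _)]
    exact max_le zero_le_one (min_le_left _ _)
  have hvv : v =ᵐ[leb01] v₀ := by
    filter_upwards [h01] with x hx
    simp [v₀, hx.1, hx.2]
  rw [← ENNReal.ofReal_coe_nnreal]
  refine limitFunctional_le_of_forall_test h01 fun φ hφ => ?_
  have hset : volume.real {x ∈ Ioo (0 : ℝ) 1 | 0 < v x ∧ v x < 1} =
      volume.real {x ∈ Ioo (0 : ℝ) 1 | 0 < v₀ x ∧ v₀ x < 1} :=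
    congrArg ENNReal.toReal (volume_between_congr hvv)
  have hint : ∫ x in (0 : ℝ)..1, v x * deriv φ x = ∫ x in (0 : ℝ)..1, v₀ x * deriv φ x := by
    rw [← integral_leb01, ← integral_leb01]
    exact integral_congr_ae (hvv.mul (ae_eq_refl _))
  rw [hset, hint]
  refine volume_mixed_add_le fun δ hδ hδ1 => ?_
  refine volume_middle_add_le hn0 hn (b := fun k => siteValues (n k) (w k))
    (fun k i hi => siteValues_eq_zero_or_one (hw k) hi) (fun k => ?_) hv₀ hv₀b (fun g hg => ?_)
    hφ hδ hδ1
  · rw [← spinEnergy_eq (hn2 k)]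
    have := hwc k
    rw [← ENNReal.ofReal_coe_nnreal] at this
    exact (ENNReal.ofReal_lt_ofReal_iff'.1 this).1.le
  · have h1 := hconv g hg
    have h2 : ∫ x, v x * g x ∂leb01 = ∫ x, v₀ x * g x ∂leb01 :=
      integral_congr_ae (hvv.mul (ae_eq_refl g))
    rw [h2] at h1
    refine h1.congr fun k => ?_
    exact integral_congr_ae ((ae_eq_stepFun (hn0 k) (hw k) (hyw k)).mul (ae_eq_refl g))

lemma limitFunctional_le_of_eventually {n : ℕ → ℕ} (hn : Tendsto n atTop atTop)
    {y : ℕ → Linf01} {v : Linf01} (hconv : WeakStarConv y v) {c : ℝ≥0∞}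
    (hc : ∀ᶠ k in atTop, discreteFunctional (n k) (y k) < c) : limitFunctional v ≤ c := by
  induction c with
  | top => exact le_top
  | coe c =>
    obtain ⟨K, hK⟩ := eventually_atTop.1 (hc.and (hn.eventually_ge_atTop 2))
    have ht := tendsto_add_atTop_nat K
    exact limitFunctional_le_of_tendsto (n := fun k => n (k + K)) (y := fun k => y (k + K))
      (fun k => (hK _ (Nat.le_add_left _ _)).2) (hn.comp ht) (fun g hg => (hconv g hg).comp ht)
      fun k => (hK _ (Nat.le_add_left _ _)).1

lemma WeakStarConv.comp {y : ℕ → Linf01} {v : Linf01} (h : WeakStarConv y v) {φ : ℕ → ℕ}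
    (hφ : Tendsto φ atTop atTop) : WeakStarConv (fun k => y (φ k)) v :=
  fun g hg => (h g hg).comp hφ

/-- For each c above the liminf, some subsequence has all energies below c, and weak-* convergence
passes to it. -/
lemma limitFunctional_le_liminf {u : ℕ → Linf01} {v : Linf01} (hconv : WeakStarConv u v) :
    limitFunctional v ≤ liminf (fun n => discreteFunctional n (u n)) atTop := by
  refine le_of_forall_gt_imp_ge_of_dense fun c hc => ?_
  obtain ⟨φ, hφ, hφc⟩ := extraction_of_frequently_atTop (frequently_lt_of_liminf_lt (by isBoundedDefault) hc)
  exact limitFunctional_le_of_eventually hφ.tendsto_atTop (hconv.comp hφ.tendsto_atTop)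
    (Eventually.of_forall hφc)

/-! ### Weak-* compactness -/

/-- For bounded sequences it suffices to test weak-* convergence with continuous functions. -/
lemma weakStarConv_of_continuous {y : ℕ → Linf01} {v : Linf01}
    (hy : ∀ᶠ k in atTop, ∀ᵐ x ∂leb01, |y k x| ≤ 1) (hv : ∀ᵐ x ∂leb01, |v x| ≤ 1)
    (h : ∀ g : ℝ → ℝ, Continuous g → HasCompactSupport g →
      Tendsto (fun k => ∫ x, y k x * g x ∂leb01) atTop (𝓝 (∫ x, v x * g x ∂leb01))) :
    WeakStarConv y v := by
  intro g hg
  have key : ∀ (w : Linf01), (∀ᵐ x ∂leb01, |w x| ≤ 1) → ∀ g' : ℝ → ℝ, Integrable g' leb01 →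
      |∫ x, w x * g x ∂leb01 - ∫ x, w x * g' x ∂leb01| ≤ ∫ x, ‖g x - g' x‖ ∂leb01 := by
    intro w hw g' hg'
    rw [← integral_sub (integrable_Linf_mul w hg) (integrable_Linf_mul w hg'), ← Real.norm_eq_abs]
    refine norm_integral_le_of_norm_le (hg.sub hg').norm ?_
    filter_upwards [hw] with x hx
    rw [← mul_sub, norm_mul]
    exact mul_le_of_le_one_left (norm_nonneg _) hx
  rw [Metric.tendsto_atTop']
  intro ε hε
  obtain ⟨g', hc, hg', hcont, hgi⟩ :=
    hg.exists_hasCompactSupport_integral_sub_le (show (0 : ℝ) < ε / 4 by positivity)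
  have h1 := key v hv g' hgi
  have h2 := (Metric.tendsto_nhds.1 (h g' hcont hc) (ε / 4) (by positivity)).and hy
  obtain ⟨K, hK⟩ := eventually_atTop.1 h2
  refine ⟨K, fun k hk => ?_⟩
  obtain ⟨h3, h4⟩ := hK k hk.le
  have h5 := key (y k) h4 g' hgi
  rw [Real.dist_eq] at h3 ⊢
  rw [abs_lt] at h3 ⊢
  rw [abs_le] at h1 h5
  constructor <;> linarith [h1.1, h1.2, h5.1, h5.2, h3.1, h3.2]

/-- Sequential Banach–Alaoglu, transported from the dual by the Riesz isomorphism. -/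
lemma exists_tendsto_inner_subseq {E : Type*} [NormedAddCommGroup E] [InnerProductSpace ℝ E]
    [CompleteSpace E] [TopologicalSpace.SeparableSpace E] {Y : ℕ → E} {R : ℝ}
    (hY : ∀ k, ‖Y k‖ ≤ R) :
    ∃ (φ : ℕ → ℕ) (V : E), StrictMono φ ∧
      ∀ g : E, Tendsto (fun k => inner ℝ (Y (φ k)) g) atTop (𝓝 (inner ℝ V g)) := by
  have hmem : ∀ k, StrongDual.toWeakDual (InnerProductSpace.toDual ℝ E (Y k)) ∈
      WeakDual.toStrongDual ⁻¹' Metric.closedBall (0 : StrongDual ℝ E) R := by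
    intro k
    simpa using hY k
  obtain ⟨l, -, φ, hφ, hl⟩ := WeakDual.isSeqCompact_closedBall ℝ E 0 R hmem
  refine ⟨φ, (InnerProductSpace.toDual ℝ E).symm (WeakDual.toStrongDual l), hφ, fun g => ?_⟩
  have h1 := ((WeakDual.eval_continuous g).tendsto l).comp hl
  rw [InnerProductSpace.toDual_symm_apply]
  exact h1

/-- Sequential weak-* compactness of the functions with values in `[0,1]`. -/
lemma exists_weakStarConv_subseq {y : ℕ → Linf01}
    (hy : ∀ k, ∀ᵐ x ∂leb01, 0 ≤ y k x ∧ y k x ≤ 1) :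
    ∃ (φ : ℕ → ℕ) (v : Linf01), StrictMono φ ∧ WeakStarConv (fun k => y (φ k)) v := by
  -- The limit is found in the separable Hilbert space L². Its values lie in [0,1], so it belongs to
  -- L^∞, and the convergence extends from L² to L¹ test functions by density.
  have hy2 : ∀ k, MemLp (y k) 2 leb01 := fun k => (Lp.memLp (y k)).mono_exponent le_top
  have hYe : ∀ k, (hy2 k).toLp (y k) =ᵐ[leb01] y k := fun k => (hy2 k).coeFn_toLp
  have hyb : ∀ k, ∀ᵐ x ∂leb01, |y k x| ≤ 1 := fun k => (hy k).mono fun x hx => by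
    rw [abs_of_nonneg hx.1]; exact hx.2
  have : Fact ((2 : ℝ≥0∞) ≠ ∞) := ⟨by simp⟩
  obtain ⟨φ, V, hφ, hV⟩ := exists_tendsto_inner_subseq (Y := fun k => (hy2 k).toLp (y k))
    (R := leb01.real univ ^ ((2 : ℝ≥0∞).toReal)⁻¹ * 1) fun k => by
      refine Lp.norm_le_of_ae_bound zero_le_one ?_
      filter_upwards [hYe k, hyb k] with x h1 h2
      rwa [h1]
  have hVt : ∀ g : ℝ → ℝ, MemLp g 2 leb01 → Tendsto (fun k => ∫ x, y (φ k) x * g x ∂leb01) atTop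
      (𝓝 (∫ x, V x * g x ∂leb01)) := by
    intro g hg
    have h1 := hV (hg.toLp g)
    simp only [L2.inner_def] at h1
    have h2 : ∫ x, inner ℝ (V x) (hg.toLp g x) ∂leb01 = ∫ x, V x * g x ∂leb01 := by
      refine integral_congr_ae ?_
      filter_upwards [hg.coeFn_toLp] with x hx
      rw [hx]
      simp [mul_comm]
    rw [h2] at h1
    refine h1.congr fun k => integral_congr_ae ?_
    filter_upwards [hg.coeFn_toLp, hYe (φ k)] with x hx hx'
    rw [hx, hx']
    simp [mul_comm]
  have hVi : Integrable V leb01 := (Lp.memLp V).integrable (by norm_num)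
  have hV01 : ∀ᵐ x ∂leb01, 0 ≤ V x ∧ V x ≤ 1 := by
    refine ae_mem_Icc_of_tendsto_setIntegral (y := fun k => y (φ k))
      (fun k => integrable_Linf _) hVi (fun S hS => ?_) fun k => hy _
    have h1 := hVt (S.indicator fun _ => 1) ((memLp_const (1 : ℝ)).indicator hS)
    simpa only [integral_mul_indicator hS] using h1
  have hVinf : MemLp V ∞ leb01 := by
    refine memLp_top_of_bound (Lp.aestronglyMeasurable V) 1 (hV01.mono fun x hx => ?_)
    rw [Real.norm_eq_abs, abs_of_nonneg hx.1]
    exact hx.2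
  refine ⟨φ, hVinf.toLp V, hφ, weakStarConv_of_continuous (Eventually.of_forall fun k => hyb _) ?_
    fun g hg hgc => ?_⟩
  · filter_upwards [hVinf.coeFn_toLp, hV01] with x h1 h2
    rw [h1, abs_of_nonneg h2.1]
    exact h2.2
  · have h1 := hVt g ((hg.memLp_of_hasCompactSupport hgc).restrict _)
    have h2 : ∫ x, hVinf.toLp V x * g x ∂leb01 = ∫ x, V x * g x ∂leb01 :=
      integral_congr_ae (hVinf.coeFn_toLp.mul (ae_eq_refl g))
    rwa [h2]

theorem compactness (u : ℕ → Linf01) (C : ℝ≥0)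
    (hu : ∀ n : ℕ, 1 ≤ n → discreteFunctional n (u n) ≤ (C : ℝ≥0∞)) :
    ∃ (φ : ℕ → ℕ) (v : Linf01), StrictMono φ ∧ MemBV v ∧ WeakStarConv (fun k => u (φ k)) v ∧
      limitFunctional v ≤ liminf (fun n => discreteFunctional n (u n)) atTop := by
  set L := liminf (fun n => discreteFunctional n (u n)) atTop
  have hLC : L ≤ C := by
    refine liminf_le_of_frequently_le' (Eventually.frequently ?_)
    filter_upwards [eventually_ge_atTop 1] with n hn using hu n hn
  -- Levels decreasing to L select indices whose energies approach the liminf of the whole sequence,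
  -- so the later extraction still compares with L.
  obtain ⟨e, -, he, heL⟩ := exists_seq_strictAnti_tendsto' (hLC.trans_lt ENNReal.coe_lt_top)
  have hfreq : ∀ k, ∃ᶠ n in atTop, discreteFunctional n (u n) < e k := fun k =>
    frequently_lt_of_liminf_lt (by isBoundedDefault) (he k).1
  obtain ⟨ψ, hψ, hψe⟩ := extraction_forall_of_frequently fun k =>
    (hfreq k).and_eventually (eventually_ge_atTop 1)
  obtain ⟨θ, v, hθ, hv⟩ := exists_weakStarConv_subseq (y := fun k => u (ψ k)) fun k =>
    ae_mem_Icc_of_discreteFunctional_lt_top (hψe k).2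
      ((hu _ (hψe k).2).trans_lt ENNReal.coe_lt_top)
  have hle : limitFunctional v ≤ L := by
    refine le_of_forall_gt_imp_ge_of_dense fun c hc => ?_
    refine limitFunctional_le_of_eventually (n := fun k => ψ (θ k))
      (hψ.tendsto_atTop.comp hθ.tendsto_atTop) hv ?_
    filter_upwards [hθ.tendsto_atTop.eventually (heL.eventually_lt_const hc)] with k hk
    exact (hψe _).1.trans hk
  refine ⟨fun k => ψ (θ k), v, hψ.comp hθ, ?_, hv, hle⟩
  by_contra hBV
  rw [limitFunctional, if_neg fun h => hBV h.1] at hle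
  exact absurd (hle.trans hLC) (by simp)

/-! ### Pointwise variation of a BV function -/

/-- A combination of translates of a primitive of a mollifier, whose derivative tests the
variation of a mollified function along the points `x 0, …, x m`. -/
def variationTest (ρ : ℝ → ℝ) (x σ : ℕ → ℝ) (m : ℕ) (t : ℝ) : ℝ :=
  ∑ i ∈ Finset.range m,
    σ i * ((∫ y in (0 : ℝ)..(x i - t), ρ y) - ∫ y in (0 : ℝ)..(x (i + 1) - t), ρ y)

lemma hasDerivAt_variationTest {ρ : ℝ → ℝ} (hρ : Continuous ρ) (x σ : ℕ → ℝ) (m : ℕ) (t : ℝ) :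
    HasDerivAt (variationTest ρ x σ m)
      (∑ i ∈ Finset.range m, σ i * (ρ (x (i + 1) - t) - ρ (x i - t))) t := by
  have h1 : ∀ a : ℝ, HasDerivAt (fun t => ∫ y in (0 : ℝ)..(a - t), ρ y) (-ρ (a - t)) t := by
    intro a
    have h2 := (hρ.integral_hasStrictDerivAt 0 (a - t)).hasDerivAt
    have h3 : HasDerivAt (fun t => a - t) (-1) t := by
      simpa using (hasDerivAt_id t).const_sub a
    have h4 := h2.comp t h3
    rw [mul_neg_one] at h4
    exact h4
  have h5 := HasDerivAt.fun_sum (u := Finset.range m) fun i _ =>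
    ((h1 (x i)).sub (h1 (x (i + 1)))).const_mul (σ i)
  refine h5.congr_deriv (Finset.sum_congr rfl fun i _ => ?_)
  ring

lemma monotone_upto {x : ℕ → ℝ} {m : ℕ} (hx : ∀ i < m, x i ≤ x (i + 1)) {i j : ℕ} (hij : i ≤ j)
    (hj : j ≤ m) : x i ≤ x j := by
  induction j, hij using Nat.le_induction with
  | base => exact le_rfl
  | succ j _ ih => exact (ih (by omega)).trans (hx j (by omega))

/-- At t the function is a signed sum of the masses of ρ on the consecutive intervals [x i - t, x
(i+1) - t]; their total is at most 1. If t is farther than r outside [x 0, x m], none of these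
intervals carries mass. -/
lemma variationTest_mem {ρ : ℝ → ℝ} {r : ℝ} (hρ : Continuous ρ) (hρ0 : ∀ y, 0 ≤ ρ y)
    (hρs : ∀ y, r ≤ |y| → ρ y = 0) (hρi : Integrable ρ) (hρ1 : ∫ y, ρ y = 1)
    {x σ : ℕ → ℝ} {m : ℕ} (hx : ∀ i < m, x i ≤ x (i + 1)) (hx0 : r < x 0) (hxm : x m < 1 - r)
    (hσ : ∀ i, |σ i| ≤ 1) :
    variationTest ρ x σ m ∈ testFunctions := by
  have hd := hasDerivAt_variationTest hρ x σ m
  have hi : ∀ a b, IntervalIntegrable ρ volume a b := fun a b => hρ.intervalIntegrable a b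
  have hsub : ∀ i t, (∫ y in (0 : ℝ)..(x i - t), ρ y) - ∫ y in (0 : ℝ)..(x (i + 1) - t), ρ y =
      -∫ y in (x i - t)..(x (i + 1) - t), ρ y := by
    intro i t
    rw [← intervalIntegral.integral_interval_sub_left (hi 0 (x (i + 1) - t)) (hi 0 (x i - t)),
      neg_sub]
  have hzero : ∀ t, t ∉ Icc (x 0 - r) (x m + r) → variationTest ρ x σ m t = 0 := by
    intro t ht
    refine Finset.sum_eq_zero fun i him => ?_
    rw [Finset.mem_range] at him
    have h1 := monotone_upto hx (Nat.zero_le i) him.le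
    have h2 := monotone_upto hx (Nat.succ_le_of_lt him) le_rfl
    have h3 := hx i him
    rw [hsub, intervalIntegral.integral_zero_ae, neg_zero, mul_zero]
    refine Eventually.of_forall fun y hy => hρs y ?_
    rw [uIoc_of_le (by linarith)] at hy
    rw [le_abs]
    by_contra! hcon
    exact ht ⟨by linarith [hy.1, hy.2], by linarith [hy.1, hy.2]⟩
  refine ⟨?_, HasCompactSupport.intro isCompact_Icc hzero, ?_, fun t => ?_⟩
  · rw [contDiff_one_iff_deriv]
    refine ⟨fun t => (hd t).differentiableAt, ?_⟩
    rw [funext fun t => (hd t).deriv]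
    fun_prop
  · have h1 : tsupport (variationTest ρ x σ m) ⊆ Icc (x 0 - r) (x m + r) := by
      refine closure_minimal (fun t ht => ?_) isClosed_Icc
      by_contra hcon
      exact ht (hzero t hcon)
    exact fun t ht => ⟨by linarith [(h1 ht).1], by linarith [(h1 ht).2]⟩
  · calc |variationTest ρ x σ m t| ≤ ∑ i ∈ Finset.range m, |σ i *
          ((∫ y in (0 : ℝ)..(x i - t), ρ y) - ∫ y in (0 : ℝ)..(x (i + 1) - t), ρ y)| :=
        Finset.abs_sum_le_sum_abs _ _
      _ ≤ ∑ i ∈ Finset.range m, ∫ y in (x i - t)..(x (i + 1) - t), ρ y := by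
        refine Finset.sum_le_sum fun i him => ?_
        rw [hsub, abs_mul, abs_neg, abs_of_nonneg (intervalIntegral.integral_nonneg
          (by linarith [hx i (Finset.mem_range.1 him)]) fun y _ => hρ0 y)]
        exact mul_le_of_le_one_left (intervalIntegral.integral_nonneg
          (by linarith [hx i (Finset.mem_range.1 him)]) fun y _ => hρ0 y) (hσ i)
      _ = ∫ y in (x 0 - t)..(x m - t), ρ y :=
        intervalIntegral.sum_integral_adjacent_intervals (a := fun i => x i - t) fun _ _ => hi _ _
      _ ≤ ∫ y, ρ y := by
        rw [intervalIntegral.integral_of_le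
          (by linarith [monotone_upto hx (Nat.zero_le m) le_rfl])]
        exact setIntegral_le_integral hρi (Eventually.of_forall hρ0)
      _ = 1 := hρ1

lemma integral_test_le_totalVar {u φ : ℝ → ℝ} (hu : totalVar u < ∞) (hφ : φ ∈ testFunctions) :
    ∫ x, u x * deriv φ x ∂leb01 ≤ (totalVar u).toReal := by
  rw [← ENNReal.ofReal_le_iff_le_toReal hu.ne]
  exact le_iSup₂ (f := fun φ _ => ENNReal.ofReal (∫ x, u x * deriv φ x ∂leb01)) φ hφ

/-- Duality: with σ the signs of the increments of the mollified function, the derivative of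
`variationTest` integrates against u to exactly the sum of their absolute values. -/
lemma sum_abs_mollified_le {u : ℝ → ℝ} (hui : Integrable u leb01) (hu : totalVar u < ∞)
    {ρ : ℝ → ℝ} {r : ℝ} (hρ : Continuous ρ) (hρ0 : ∀ y, 0 ≤ ρ y)
    (hρs : ∀ y, r ≤ |y| → ρ y = 0) (hρi : Integrable ρ) (hρ1 : ∫ y, ρ y = 1)
    (hρb : ∃ K, ∀ y, ‖ρ y‖ ≤ K)
    {x : ℕ → ℝ} {m : ℕ} (hx : ∀ i < m, x i ≤ x (i + 1)) (hx0 : r < x 0) (hxm : x m < 1 - r) :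
    ∑ i ∈ Finset.range m, |(∫ t, u t * ρ (x (i + 1) - t) ∂leb01) - ∫ t, u t * ρ (x i - t) ∂leb01| ≤
      (totalVar u).toReal := by
  obtain ⟨K, hK⟩ := hρb
  set M : ℝ → ℝ := fun z => ∫ t, u t * ρ (z - t) ∂leb01
  set σ : ℕ → ℝ := fun i => if 0 ≤ M (x (i + 1)) - M (x i) then 1 else -1
  have hσ : ∀ i, |σ i| ≤ 1 := fun i => by
    simp only [σ]; split_ifs <;> simp
  have hσM : ∀ i, |M (x (i + 1)) - M (x i)| = σ i * (M (x (i + 1)) - M (x i)) := fun i => by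
    simp only [σ]
    split_ifs with h
    · rw [abs_of_nonneg h, one_mul]
    · rw [abs_of_neg (not_le.1 h), neg_one_mul]
  have hφ := variationTest_mem hρ hρ0 hρs hρi hρ1 hx hx0 hxm hσ
  have hint : ∀ z : ℝ, Integrable (fun t => u t * ρ (z - t)) leb01 := fun z =>
    hui.mul_bdd (hρ.comp (continuous_sub_left z)).aestronglyMeasurable
      (Eventually.of_forall fun t => hK _)
  refine le_trans (le_of_eq ?_) (integral_test_le_totalVar hu hφ)
  rw [funext fun t => (hasDerivAt_variationTest hρ x σ m t).deriv]
  rw [Finset.sum_congr rfl fun i _ => hσM i]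
  simp_rw [Finset.mul_sum]
  have h1 : ∀ i t, u t * (σ i * (ρ (x (i + 1) - t) - ρ (x i - t))) =
      σ i * (u t * ρ (x (i + 1) - t) - u t * ρ (x i - t)) := fun i t => by ring
  simp_rw [h1]
  have h2 : ∀ i, Integrable
      (fun t => σ i * (u t * ρ (x (i + 1) - t) - u t * ρ (x i - t))) leb01 := fun i =>
    ((hint _).sub (hint _)).const_mul _
  rw [integral_finsetSum _ fun i _ => h2 i]
  refine Finset.sum_congr rfl fun i _ => ?_
  rw [integral_const_mul, integral_sub (hint _) (hint _)]

/-- A function of bounded variation has, off a null set, pointwise variation at most `|Du|`. -/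
lemma exists_set_variation_le {u : ℝ → ℝ} (hu : MemBV u) :
    ∃ S ⊆ Ioo (0 : ℝ) 1, (∀ᵐ x, x ∈ Ioo (0 : ℝ) 1 → x ∈ S) ∧
      ∀ (x : ℕ → ℝ) (m : ℕ), (∀ i < m, x i ≤ x (i + 1)) → (∀ i ≤ m, x i ∈ S) →
        ∑ i ∈ Finset.range m, |u (x (i + 1)) - u (x i)| ≤ (totalVar u).toReal := by
  set U : ℝ → ℝ := (Ioo (0 : ℝ) 1).indicator u
  have hU : Integrable U := (integrable_indicator_iff measurableSet_Ioo).2 hu.1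
  -- The ratio of outer to inner radius stays 2, as required for almost everywhere convergence of
  -- the mollifications.
  set B : ℕ → ContDiffBump (0 : ℝ) := fun j =>
    { rIn := 1 / ((j : ℝ) + 1)
      rOut := 2 / ((j : ℝ) + 1)
      rIn_pos := by positivity
      rIn_lt_rOut := by gcongr; norm_num }
  have hB0 : Tendsto (fun j => (B j).rOut) atTop (𝓝 0) := by
    have := (tendsto_one_div_add_atTop_nhds_zero_nat (𝕜 := ℝ)).const_mul 2
    simpa [B, div_eq_mul_inv] using this
  have hae := ContDiffBump.ae_convolution_tendsto_right_of_locallyIntegrable (μ := volume)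
    (φ := B) (K := 2) hB0 (Eventually.of_forall fun j => by simp [B]; ring_nf; rfl)
    hU.locallyIntegrable
  have hconv : ∀ j z, MeasureTheory.convolution ((B j).normed volume) U
      (ContinuousLinearMap.lsmul ℝ ℝ) volume z =
      ∫ t, u t * (B j).normed volume (z - t) ∂leb01 := by
    intro j z
    rw [convolution_eq_swap, ← integral_indicator measurableSet_Ioo]
    congr 1
    funext t
    by_cases ht : t ∈ Ioo (0 : ℝ) 1 <;> simp [U, ht, mul_comm]
  -- S consists of the points where the mollifications converge to u; for finitely many of them, the
  -- mollified bound passes to the limit.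
  refine ⟨{x ∈ Ioo (0 : ℝ) 1 | Tendsto (fun j => ∫ t, u t * (B j).normed volume (x - t) ∂leb01)
    atTop (𝓝 (u x))}, fun x hx => hx.1, ?_, fun x m hx hxS => ?_⟩
  · filter_upwards [hae] with x hx hx1
    refine ⟨hx1, ?_⟩
    simp_rw [hconv] at hx
    simpa [U, hx1] using hx
  · have hlim : Tendsto (fun j => ∑ i ∈ Finset.range m,
        |(∫ t, u t * (B j).normed volume (x (i + 1) - t) ∂leb01) -
          ∫ t, u t * (B j).normed volume (x i - t) ∂leb01|) atTop
        (𝓝 (∑ i ∈ Finset.range m, |u (x (i + 1)) - u (x i)|)) := by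
      refine tendsto_finsetSum _ fun i hi => ?_
      rw [Finset.mem_range] at hi
      exact ((hxS (i + 1) hi).2.sub (hxS i hi.le).2).abs
    refine le_of_tendsto hlim ?_
    filter_upwards [hB0.eventually_lt_const (hxS 0 (Nat.zero_le m)).1.1,
      hB0.eventually_lt_const (sub_pos.2 (hxS m le_rfl).1.2)] with j h1 h2
    have hcs := (B j).hasCompactSupport_normed (μ := volume)
    have hcont := (B j).continuous_normed (μ := volume)
    refine sum_abs_mollified_le hu.1 hu.2 hcont (fun y => (B j).nonneg_normed y) (fun y hy => ?_)
      (B j).integrable_normed (B j).integral_normed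
      (hcont.bounded_above_of_compact_support hcs) hx h1 (by linarith)
    have : y ∉ Function.support ((B j).normed volume) := by
      rw [(B j).support_normed_eq]
      simpa using hy
    simpa using this

/-! ### Rounding with a random offset -/

lemma leb01_univ : leb01 univ = 1 := by simp

lemma isProbabilityMeasure_leb01 : IsProbabilityMeasure leb01 := ⟨leb01_univ⟩

lemma floor_add_eq {a θ : ℝ} (hθ : θ ∈ Ioo (0 : ℝ) 1) :
    (⌊a + θ⌋ : ℝ) = ⌊a⌋ + (Ico (1 - Int.fract a) 1).indicator (fun _ => (1 : ℝ)) θ := by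
  have h0 := Int.floor_add_fract a
  have h1 := Int.fract_nonneg a
  have h2 := Int.fract_lt_one a
  by_cases h : 1 - Int.fract a ≤ θ
  · rw [indicator_of_mem (show θ ∈ Ico (1 - Int.fract a) 1 from ⟨h, hθ.2⟩)]
    have : ⌊a + θ⌋ = ⌊a⌋ + 1 := by
      rw [Int.floor_eq_iff]
      push_cast
      constructor <;> linarith [hθ.1, hθ.2]
    rw [this]
    push_cast
    ring
  · rw [indicator_of_notMem fun h' => h h'.1, add_zero]
    have : ⌊a + θ⌋ = ⌊a⌋ := by
      rw [Int.floor_eq_iff]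
      constructor <;> linarith [hθ.1, hθ.2]
    rw [this]

lemma floor_add_ae_eq (a : ℝ) : (fun θ : ℝ => (⌊a + θ⌋ : ℝ)) =ᵐ[leb01]
    fun θ => ⌊a⌋ + (Ico (1 - Int.fract a) 1).indicator (fun _ => (1 : ℝ)) θ := by
  filter_upwards [ae_restrict_mem measurableSet_Ioo] with θ hθ using floor_add_eq hθ

lemma integrable_floor_add (a : ℝ) : Integrable (fun θ : ℝ => (⌊a + θ⌋ : ℝ)) leb01 :=
  ((integrable_const _).add ((integrable_const _).indicator measurableSet_Ico)).congr
    (floor_add_ae_eq a).symm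

/-- Rounding with a uniform offset is unbiased: a + θ passes the next integer with probability equal
to the fractional part of a. -/
lemma integral_floor_add (a : ℝ) : ∫ θ, (⌊a + θ⌋ : ℝ) ∂leb01 = a := by
  have := isProbabilityMeasure_leb01
  have h1 := Int.fract_nonneg a
  have h2 := Int.fract_lt_one a
  rw [integral_congr_ae (floor_add_ae_eq a), integral_add (integrable_const _)
    ((integrable_const _).indicator measurableSet_Ico), integral_indicator measurableSet_Ico,
    leb01, Measure.restrict_congr_set Ioo_ae_eq_Ico, Measure.restrict_restrict measurableSet_Ico,
    inter_eq_left.2 (Ico_subset_Ico_left (by linarith : (0 : ℝ) ≤ 1 - Int.fract a))]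
  simp [h1]

/-- With a common offset, rounding is monotone, so the absolute value can be dropped and
unbiasedness applied. -/
lemma integral_abs_floor_sub (a b : ℝ) :
    ∫ θ, |(⌊a + θ⌋ : ℝ) - ⌊b + θ⌋| ∂leb01 = |a - b| := by
  wlog h : b ≤ a generalizing a b
  · simp_rw [abs_sub_comm _ (⌊b + _⌋ : ℝ)]
    rw [this b a (not_le.1 h).le, abs_sub_comm]
  have h1 : ∀ θ : ℝ, |(⌊a + θ⌋ : ℝ) - ⌊b + θ⌋| = (⌊a + θ⌋ : ℝ) - ⌊b + θ⌋ := fun θ => by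
    refine abs_of_nonneg (sub_nonneg.2 ?_)
    exact_mod_cast Int.floor_le_floor (by linarith)
  simp_rw [h1]
  rw [integral_sub (integrable_floor_add a) (integrable_floor_add b), integral_floor_add,
    integral_floor_add, abs_of_nonneg (sub_nonneg.2 h)]

/-- A finite sequence of reals can be rounded to integers without increasing its variation. -/
lemma exists_rounding (a : ℕ → ℝ) (m : ℕ) :
    ∃ θ ∈ Ioo (0 : ℝ) 1, ∑ r ∈ Finset.range m, |(⌊a (r + 1) + θ⌋ : ℝ) - ⌊a r + θ⌋| ≤
      ∑ r ∈ Finset.range m, |a (r + 1) - a r| := by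
  have := isProbabilityMeasure_leb01
  have hi : ∀ r, Integrable (fun θ : ℝ => |(⌊a (r + 1) + θ⌋ : ℝ) - ⌊a r + θ⌋|) leb01 := fun r =>
    ((integrable_floor_add _).sub (integrable_floor_add _)).abs
  obtain ⟨θ, hθ, hle⟩ := exists_notMem_null_le_integral (μ := leb01)
    (f := fun θ : ℝ => ∑ r ∈ Finset.range m, |(⌊a (r + 1) + θ⌋ : ℝ) - ⌊a r + θ⌋|)
    (N := (Ioo (0 : ℝ) 1)ᶜ) (integrable_finsetSum _ fun r _ => hi r) (by simp [leb01])
  rw [integral_finsetSum _ fun r _ => hi r] at hle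
  simp_rw [integral_abs_floor_sub] at hle
  exact ⟨θ, notMem_compl_iff.1 hθ, hle⟩

/-- The k r are the floors of n·u r + θ with one θ for all r. Since 0 < θ < 1, the extreme values 0
and n are fixed, so rounding makes no pure row mixed. -/
lemma exists_nat_rounding {n : ℕ} {u : ℕ → ℝ} (hu : ∀ r, 0 ≤ u r ∧ u r ≤ 1) (m : ℕ) :
    ∃ k : ℕ → ℕ, (∀ r, k r ≤ n) ∧ (∀ r, u r = 0 → k r = 0) ∧ (∀ r, u r = 1 → k r = n) ∧
      (∀ r, |(k r : ℝ) - n * u r| ≤ 1) ∧ (∀ r s, u r = u s → k r = k s) ∧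
      ∑ r ∈ Finset.range m, |(k (r + 1) : ℝ) - k r| ≤
        n * ∑ r ∈ Finset.range m, |u (r + 1) - u r| := by
  obtain ⟨θ, hθ, hle⟩ := exists_rounding (fun r => n * u r) m
  have hnn : ∀ r, (0 : ℝ) ≤ n * u r := fun r => mul_nonneg (Nat.cast_nonneg n) (hu r).1
  have hk : ∀ r, ((⌊n * u r + θ⌋₊ : ℕ) : ℝ) = (⌊n * u r + θ⌋ : ℝ) := fun r => by
    rw [natCast_floor_eq_intCast_floor (by linarith [hθ.1, hnn r])]
  refine ⟨fun r => ⌊n * u r + θ⌋₊, fun r => ?_, fun r hr => ?_, fun r hr => ?_, fun r => ?_,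
    fun r s h => ?_, ?_⟩
  · rw [← Nat.lt_add_one_iff, Nat.floor_lt (by linarith [hθ.1, hnn r])]
    push_cast
    nlinarith [hθ.2, (hu r).2, (Nat.cast_nonneg n : (0 : ℝ) ≤ n)]
  · simp only [hr, mul_zero, zero_add, Nat.floor_eq_zero]
    exact hθ.2
  · simp only [hr, mul_one]
    rw [Nat.floor_eq_iff (by linarith [hθ.1, (Nat.cast_nonneg n : (0 : ℝ) ≤ n)])]
    constructor <;> linarith [hθ.1, hθ.2]
  · have h1 := Nat.floor_le (a := n * u r + θ) (by linarith [hθ.1, hnn r])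
    have h2 := Nat.lt_floor_add_one (n * u r + θ)
    rw [abs_le]
    constructor <;> linarith [hθ.1, hθ.2]
  · simp only [h]
  · simp_rw [hk]
    refine hle.trans (le_of_eq ?_)
    rw [Finset.mul_sum]
    refine Finset.sum_congr rfl fun r _ => ?_
    rw [← mul_sub, abs_mul, abs_of_nonneg (Nat.cast_nonneg n)]

/-! ### Energy of configurations filled row by row -/

/-- The configuration whose row `r` starts with `k r` ones. -/
def rowConfig (n : ℕ) (k : ℕ → ℕ) (i : ℕ) : ℝ := if i % n < k (i / n) then 1 else 0

lemma rowConfig_eq_zero_or_one (n : ℕ) (k : ℕ → ℕ) (i : ℕ) :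
    rowConfig n k i = 0 ∨ rowConfig n k i = 1 := by
  rw [rowConfig]; split_ifs <;> simp

lemma rowConfig_mul_add {n : ℕ} (k : ℕ → ℕ) (r : ℕ) {c : ℕ} (hc : c < n) :
    rowConfig n k (n * r + c) = if c < k r then 1 else 0 := by
  rw [rowConfig, Nat.mul_add_mod, Nat.mod_eq_of_lt hc, Nat.mul_add_div (by omega),
    Nat.div_eq_of_lt hc, add_zero]

lemma sum_range_rows (n m : ℕ) (f : ℕ → ℝ) :
    ∑ i ∈ Finset.range (n * m), f i =
      ∑ r ∈ Finset.range m, ∑ c ∈ Finset.range n, f (n * r + c) := by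
  induction m with
  | zero => simp
  | succ m ih => rw [Nat.mul_succ, Finset.sum_range_add, ih, Finset.sum_range_succ]

lemma sum_indicator_lt {n a : ℕ} (ha : a ≤ n) :
    ∑ c ∈ Finset.range n, (if c < a then (1 : ℝ) else 0) = a := by
  rw [← Finset.sum_filter, Finset.sum_const, nsmul_eq_mul, mul_one]
  have : (Finset.range n).filter (fun c => c < a) = Finset.range a := by
    ext c; simp only [Finset.mem_filter, Finset.mem_range]; omega
  rw [this, Finset.card_range]

lemma sum_sq_indicator_sub {n a b : ℕ} (ha : a ≤ n) (hb : b ≤ n) :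
    ∑ c ∈ Finset.range n, ((if c < a then (1 : ℝ) else 0) - if c < b then 1 else 0) ^ 2 =
      |(b : ℝ) - a| := by
  wlog h : a ≤ b generalizing a b
  · rw [abs_sub_comm, ← this hb ha (by omega)]
    exact Finset.sum_congr rfl fun c _ => by ring
  have h1 : ∀ c, ((if c < a then (1 : ℝ) else 0) - if c < b then 1 else 0) ^ 2 =
      (if c < b then (1 : ℝ) else 0) - if c < a then 1 else 0 := by
    intro c
    split_ifs <;> first | omega | norm_num
  simp_rw [h1]
  rw [Finset.sum_sub_distrib, sum_indicator_lt ha, sum_indicator_lt hb, abs_of_nonneg]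
  exact sub_nonneg.2 (by exact_mod_cast h)

lemma verticalJumps_rowConfig {n : ℕ} {k : ℕ → ℕ} (hk : ∀ r, k r ≤ n) :
    verticalJumps n (rowConfig n k) = ∑ r ∈ Finset.range (n - 1), |(k (r + 1) : ℝ) - k r| := by
  rw [verticalJumps, show n ^ 2 - n = n * (n - 1) by rw [sq, Nat.mul_sub, mul_one],
    sum_range_rows]
  refine Finset.sum_congr rfl fun r _ => ?_
  rw [← sum_sq_indicator_sub (hk r) (hk (r + 1))]
  refine Finset.sum_congr rfl fun c hc => ?_
  rw [Finset.mem_range] at hc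
  rw [show n * r + c + n = n * (r + 1) + c by ring, rowConfig_mul_add k r hc,
    rowConfig_mul_add k (r + 1) hc]

/-- Upward minus downward jumps equals b m - b 0, and the products `b i * (1 - b (i + 1))` count the
downward jumps. -/
lemma sum_sq_sub_eq {b : ℕ → ℝ} (hb : ∀ i, b i = 0 ∨ b i = 1) (m : ℕ) :
    ∑ i ∈ Finset.range m, (b i - b (i + 1)) ^ 2 =
      b m - b 0 + 2 * ∑ i ∈ Finset.range m, b i * (1 - b (i + 1)) := by
  induction m with
  | zero => simp
  | succ m ih =>
    rw [Finset.sum_range_succ, Finset.sum_range_succ, ih]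
    rcases hb m with h | h <;> rcases hb (m + 1) with h' | h' <;> rw [h, h'] <;> ring

open scoped Classical in
/-- The rows that contain both values. -/
def mixedRows (n : ℕ) (k : ℕ → ℕ) : Finset ℕ :=
  (Finset.range n).filter fun r => 0 < k r ∧ k r < n

/-- It suffices to count drops, of which a row has at most one. It occurs inside a mixed row, or at
the end of a full row followed by a zero; in the latter case |k (r+1) - k r|/n = 1 pays for it. -/
lemma horizontalJumps_rowConfig_le {n : ℕ} (hn : 0 < n) {k : ℕ → ℕ} (hk : ∀ r, k r ≤ n) :
    horizontalJumps n (rowConfig n k) ≤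
      1 + 2 * ((mixedRows n k).card + (∑ r ∈ Finset.range n, |(k (r + 1) : ℝ) - k r|) / n) := by
  classical
  have h01 := rowConfig_eq_zero_or_one n k
  have hn' : (0 : ℝ) < n := by exact_mod_cast hn
  have hnonneg : ∀ i, 0 ≤ rowConfig n k i * (1 - rowConfig n k (i + 1)) := fun i => by
    rcases h01 i with h | h <;> rcases h01 (i + 1) with h' | h' <;> rw [h, h'] <;> norm_num
  rw [horizontalJumps, sum_sq_sub_eq h01]
  have hends : rowConfig n k (n ^ 2 - 1) - rowConfig n k 0 ≤ 1 := by
    rcases h01 (n ^ 2 - 1) with h | h <;> rcases h01 0 with h' | h' <;> rw [h, h'] <;> norm_num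
  have hdrop : ∑ i ∈ Finset.range (n ^ 2 - 1), rowConfig n k i * (1 - rowConfig n k (i + 1)) ≤
      ∑ r ∈ Finset.range n,
        ((if 0 < k r ∧ k r < n then (1 : ℝ) else 0) + |(k (r + 1) : ℝ) - k r| / n) := by
    calc _ ≤ ∑ i ∈ Finset.range (n * n), rowConfig n k i * (1 - rowConfig n k (i + 1)) := by
          refine Finset.sum_le_sum_of_subset_of_nonneg (fun i hi => ?_) fun i _ _ => hnonneg i
          rw [Finset.mem_range] at hi ⊢
          rw [← sq]
          omega
      _ ≤ _ := by
          rw [sum_range_rows]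
          refine Finset.sum_le_sum fun r _ => ?_
          set q : ℝ := (if 0 < k r ∧ k r < n then (1 : ℝ) else 0) + |(k (r + 1) : ℝ) - k r| / n
          have hq0 : 0 ≤ q := by positivity
          -- The only possible drop sits at the last one of the row. For k r = 0 the truncated index
          -- is 0, which is harmless because q ≥ 0.
          calc _ ≤ ∑ c ∈ Finset.range n, if c = k r - 1 then q else 0 := by
                refine Finset.sum_le_sum fun c hc => ?_
                rw [Finset.mem_range] at hc
                rw [rowConfig_mul_add k r hc]
                by_cases h1 : c < k r
                · by_cases h2 : c + 1 < n
                  · rw [add_assoc, rowConfig_mul_add k r h2]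
                    by_cases h3 : c + 1 < k r
                    · simp only [h1, h3, if_true, sub_self, mul_zero]
                      split_ifs <;> simp [hq0]
                    · rw [if_pos (by omega : c = k r - 1), if_pos h1, if_neg h3]
                      have : 0 < k r ∧ k r < n := by omega
                      have h4 : 0 ≤ |(k (r + 1) : ℝ) - k r| / n := by positivity
                      simp only [q, if_pos this]
                      linarith
                  -- Last column, c = n - 1: the row is full, and the bond leads to the first site
                  -- of the next row.
                  · have h3 := hk r
                    rw [if_pos (by omega : c = k r - 1), if_pos h1,
                      show n * r + c + 1 = n * (r + 1) + 0 by rw [mul_add]; omega,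
                      rowConfig_mul_add k (r + 1) hn]
                    by_cases h4 : 0 < k (r + 1)
                    · simp [h4, hq0]
                    · have h5 : k r = n := by omega
                      have h6 : k (r + 1) = 0 := by omega
                      simp only [q, h5, h6]
                      simp [abs_of_pos hn', hn'.ne']
                · rw [if_neg h1, zero_mul]
                  split_ifs <;> simp [hq0]
            _ ≤ q := by
                rw [Finset.sum_ite_eq']
                split_ifs <;> simp [hq0]
  rw [Finset.sum_add_distrib, ← Finset.sum_div] at hdrop
  have hcard : ((mixedRows n k).card : ℝ) =
      ∑ r ∈ Finset.range n, if 0 < k r ∧ k r < n then (1 : ℝ) else 0 := by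
    rw [mixedRows, Finset.card_filter]
    push_cast
    rfl
  rw [hcard]
  linarith

/-! ### Sampling a BV function -/

lemma ae_comp_affine {p : ℝ → Prop} (hp : ∀ᵐ x, p x) {n : ℕ} (hn : 0 < n) (c : ℝ) :
    ∀ᵐ t, p ((c + t) / n) := by
  have hn' : (n : ℝ)⁻¹ ≠ 0 := by positivity
  rw [ae_iff] at hp ⊢
  have h1 : {t | ¬p ((c + t) / n)} = (fun t => c + t) ⁻¹' ((fun x => x * (n : ℝ)⁻¹) ⁻¹' {x | ¬p x}) := by
    ext t; simp [div_eq_mul_inv]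
  rw [h1, measure_preimage_add, Real.volume_preimage_mul_right hn', hp, mul_zero]

lemma add_div_mem_Ioo {n r : ℕ} (hr : r < n) {t : ℝ} (ht : t ∈ Ioo (0 : ℝ) 1) :
    ((r : ℝ) + t) / n ∈ Ioo (0 : ℝ) 1 := by
  have hn' : (0 : ℝ) < n := by exact_mod_cast (Nat.zero_le r).trans_lt hr
  have hr' : (r : ℝ) + 1 ≤ n := by exact_mod_cast hr
  exact ⟨div_pos (by linarith [ht.1, (Nat.cast_nonneg r : (0 : ℝ) ≤ r)]) hn',
    (div_lt_one hn').2 (by linarith [ht.2])⟩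

lemma ae_samples_mem {S : Set ℝ} (hS : ∀ᵐ x, x ∈ Ioo (0 : ℝ) 1 → x ∈ S) {n : ℕ} (hn : 0 < n) :
    ∀ᵐ t ∂leb01, ∀ r < n, ((r : ℝ) + t) / n ∈ S := by
  have h1 : ∀ᵐ t, ∀ r : ℕ, ((r : ℝ) + t) / n ∈ Ioo (0 : ℝ) 1 → ((r : ℝ) + t) / n ∈ S :=
    ae_all_iff.2 fun r => ae_comp_affine hS hn r
  filter_upwards [ae_restrict_of_ae h1, ae_restrict_mem measurableSet_Ioo] with t ht ht' r hr
  exact ht r (add_div_mem_Ioo hr ht')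

lemma integral_sample {n : ℕ} (hn : 0 < n) (f : ℝ → ℝ) (r : ℕ) :
    ∫ t, f (((r : ℝ) + t) / n) ∂leb01 = n * ∫ x in ((r : ℝ) / n)..(((r : ℝ) + 1) / n), f x := by
  have hn' : (n : ℝ) ≠ 0 := by positivity
  rw [integral_leb01]
  have h1 := intervalIntegral.integral_comp_div_add (a := 0) (b := 1) f hn' ((r : ℝ) / n)
  simp only [zero_div, zero_add, smul_eq_mul] at h1
  rw [show ((r : ℝ) + 1) / n = 1 / n + r / n by ring, ← h1]
  congr 1
  funext t
  congr 1
  ring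

lemma measurable_sample {f : ℝ → ℝ} (hf : Measurable f) (n r : ℕ) :
    Measurable fun t : ℝ => f (((r : ℝ) + t) / n) :=
  hf.comp ((measurable_const_add _).div_const _)

lemma integrable_leb01_of_bounded {f : ℝ → ℝ} {K : ℝ} (hf : Measurable f) (hb : ∀ x, |f x| ≤ K) :
    Integrable f leb01 :=
  Integrable.of_bound hf.aestronglyMeasurable K (Eventually.of_forall hb)

-- The mean over t of the number of samples in G is n|(0,1) ∩ G|, so some t outside the null set of
-- bad samples does not exceed it.
open scoped Classical in
lemma exists_sample {S G : Set ℝ} (hS : ∀ᵐ x, x ∈ Ioo (0 : ℝ) 1 → x ∈ S) (hG : MeasurableSet G)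
    {n : ℕ} (hn : 0 < n) :
    ∃ t ∈ Ioo (0 : ℝ) 1, (∀ r < n, ((r : ℝ) + t) / n ∈ S) ∧
      (((Finset.range n).filter fun r : ℕ => ((r : ℝ) + t) / n ∈ G).card : ℝ) ≤
        n * volume.real (Ioo 0 1 ∩ G) := by
  have := isProbabilityMeasure_leb01
  set f : ℝ → ℝ := G.indicator fun _ => 1
  have hf : Measurable f := measurable_const.indicator hG
  have hfb : ∀ x, |f x| ≤ 1 := fun x => by
    by_cases hx : x ∈ G <;> simp [f, hx]
  have hi : ∀ r : ℕ, Integrable (fun t => f (((r : ℝ) + t) / n)) leb01 := fun r =>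
    integrable_leb01_of_bounded (measurable_sample hf n r) fun _ => hfb _
  have hnull : leb01 {t | ¬(t ∈ Ioo (0 : ℝ) 1 ∧ ∀ r < n, ((r : ℝ) + t) / n ∈ S)} = 0 :=
    ae_iff.1 ((ae_restrict_mem measurableSet_Ioo).and (ae_samples_mem hS hn))
  obtain ⟨t, ht, hle⟩ := exists_notMem_null_le_integral (μ := leb01)
    (f := fun t => ∑ r ∈ Finset.range n, f (((r : ℝ) + t) / n))
    (integrable_finsetSum _ fun r _ => hi r) hnull
  simp only [mem_ofPred_eq, not_not] at ht
  refine ⟨t, ht.1, ht.2, ?_⟩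
  rw [integral_finsetSum _ fun r _ => hi r] at hle
  simp_rw [integral_sample hn] at hle
  rw [← Finset.mul_sum, ← integral_eq_sum_cells f n
    (fun a b => intervalIntegrable_of_bounded hf hfb a b), div_self (by positivity),
    ← integral_leb01, leb01, setIntegral_indicator hG] at hle
  rw [Finset.card_filter]
  push_cast
  simpa [f, indicator_apply] using hle

/-- For s ≤ t the two families interleave into one monotone chain of 2n points, and the required
increments are every other increment of the chain. -/
lemma sum_abs_interleaved_le {u : ℝ → ℝ} {S : Set ℝ} {T : ℝ}
    (hS : ∀ (x : ℕ → ℝ) (m : ℕ), (∀ i < m, x i ≤ x (i + 1)) → (∀ i ≤ m, x i ∈ S) →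
      ∑ i ∈ Finset.range m, |u (x (i + 1)) - u (x i)| ≤ T)
    {n : ℕ} (hn : 0 < n) {s t : ℝ} (hs : s ∈ Ioo (0 : ℝ) 1) (ht : t ∈ Ioo (0 : ℝ) 1)
    (hsS : ∀ r < n, ((r : ℝ) + s) / n ∈ S) (htS : ∀ r < n, ((r : ℝ) + t) / n ∈ S) :
    ∑ r ∈ Finset.range n, |u (((r : ℝ) + t) / n) - u (((r : ℝ) + s) / n)| ≤ T := by
  wlog h : s ≤ t generalizing s t
  · simp_rw [abs_sub_comm (u ((_ + t) / n))]
    exact this ht hs htS hsS (not_le.1 h).le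
  set z : ℕ → ℝ := fun i => (((i / 2 : ℕ) : ℝ) + if i % 2 = 0 then s else t) / n
  have z0 : ∀ r, z (2 * r) = ((r : ℝ) + s) / n := fun r => by simp [z]
  have z1 : ∀ r, z (2 * r + 1) = ((r : ℝ) + t) / n := fun r => by
    simp only [z, show (2 * r + 1) / 2 = r by omega, show (2 * r + 1) % 2 = 1 by omega]
    simp
  have hz := hS z (2 * n - 1) (fun i hi => ?_) fun i hi => ?_
  · refine le_trans ?_ hz
    have h1 : ∑ r ∈ Finset.range n, |u (((r : ℝ) + t) / n) - u (((r : ℝ) + s) / n)| =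
        ∑ i ∈ (Finset.range n).image (fun r => 2 * r), |u (z (i + 1)) - u (z i)| := by
      rw [Finset.sum_image fun a _ b _ hab => by simpa using hab]
      simp_rw [z0, z1]
    rw [h1]
    refine Finset.sum_le_sum_of_subset_of_nonneg (fun i hi => ?_) fun _ _ _ => abs_nonneg _
    simp only [Finset.mem_image, Finset.mem_range] at hi ⊢
    omega
  · obtain ⟨r, rfl | rfl⟩ := Nat.even_or_odd' i
    · rw [z0, z1]
      gcongr
    · rw [show 2 * r + 1 + 1 = 2 * (r + 1) by ring, z0, z1]
      push_cast
      exact div_le_div_of_nonneg_right (by linarith [hs.1, ht.2]) (Nat.cast_nonneg n)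
  · obtain ⟨r, rfl | rfl⟩ := Nat.even_or_odd' i
    · rw [z0]; exact hsS r (by omega)
    · rw [z1]; exact htS r (by omega)

/-- Integrate the interleaved bound over s: as s runs through (0,1), (r + s)/n runs through row r,
which produces the factor 1/n. -/
lemma sum_integral_rows_le {u : ℝ → ℝ} (hu : Measurable u) (hub : ∀ x, 0 ≤ u x ∧ u x ≤ 1)
    {S : Set ℝ} {T : ℝ} (hSae : ∀ᵐ x, x ∈ Ioo (0 : ℝ) 1 → x ∈ S)
    (hS : ∀ (x : ℕ → ℝ) (m : ℕ), (∀ i < m, x i ≤ x (i + 1)) → (∀ i ≤ m, x i ∈ S) →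
      ∑ i ∈ Finset.range m, |u (x (i + 1)) - u (x i)| ≤ T)
    {n : ℕ} (hn : 0 < n) {t : ℝ} (ht : t ∈ Ioo (0 : ℝ) 1)
    (htS : ∀ r < n, ((r : ℝ) + t) / n ∈ S) :
    ∑ r ∈ Finset.range n, ∫ x in ((r : ℝ) / n)..(((r : ℝ) + 1) / n),
      |u (((r : ℝ) + t) / n) - u x| ≤ T / n := by
  have := isProbabilityMeasure_leb01
  have hn' : (0 : ℝ) < n := by exact_mod_cast hn
  have hi : ∀ r : ℕ, Integrable
      (fun s => |u (((r : ℝ) + t) / n) - u (((r : ℝ) + s) / n)|) leb01 := fun r =>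
    integrable_leb01_of_bounded (K := 1) ((measurable_const.sub (measurable_sample hu n r)).abs)
      fun s => by
        rw [abs_abs, abs_le]
        constructor <;> linarith [hub (((r : ℝ) + t) / n), hub (((r : ℝ) + s) / n)]
  rw [le_div_iff₀ hn', mul_comm, Finset.mul_sum]
  simp_rw [← integral_sample hn fun x => |u ((_ + t) / n) - u x|]
  rw [← integral_finsetSum _ fun r _ => hi r]
  calc _ ≤ ∫ _, T ∂leb01 := by
        refine integral_mono_ae (integrable_finsetSum _ fun r _ => hi r) (integrable_const T) ?_
        filter_upwards [ae_samples_mem hSae hn, ae_restrict_mem measurableSet_Ioo] with s hsS hs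
        exact sum_abs_interleaved_le hS hn hs ht hsS htS
    _ = T := by simp

lemma exists_rows {u : ℝ → ℝ} (hu : Measurable u) (hub : ∀ x, 0 ≤ u x ∧ u x ≤ 1)
    (hBV : MemBV u) {n : ℕ} (hn : 0 < n) :
    ∃ k : ℕ → ℕ, (∀ r, k r ≤ n) ∧
      ∑ r ∈ Finset.range n, |(k (r + 1) : ℝ) - k r| ≤ n * (totalVar u).toReal ∧
      ((mixedRows n k).card : ℝ) ≤
        n * volume.real {x ∈ Ioo (0 : ℝ) 1 | 0 < u x ∧ u x < 1} ∧
      ∑ r ∈ Finset.range n,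
        |(k r : ℝ) / (n : ℝ) ^ 2 - ∫ x in ((r : ℝ) / n)..(((r : ℝ) + 1) / n), u x| ≤
          (1 + (totalVar u).toReal) / n := by
  classical
  have hn' : (0 : ℝ) < n := by exact_mod_cast hn
  obtain ⟨S, -, hSae, hS⟩ := exists_set_variation_le hBV
  set T := (totalVar u).toReal
  have hG : MeasurableSet {x | 0 < u x ∧ u x < 1} :=
    (measurableSet_lt measurable_const hu).inter (measurableSet_lt hu measurable_const)
  obtain ⟨t, ht, htS, htG⟩ := exists_sample hSae hG hn
  -- Freezing the last sample makes the increment from n - 1 to n vanish, as only n samples lie in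
  -- (0,1).
  set x : ℕ → ℝ := fun r => (((min r (n - 1) : ℕ) : ℝ) + t) / n
  have hx : ∀ r < n, x r = ((r : ℝ) + t) / n := fun r hr => by
    simp only [x]; rw [min_eq_left (by omega)]
  obtain ⟨k, hkn, hk0, hk1, hku, hkc, hkT⟩ :=
    exists_nat_rounding (n := n) (u := fun r => u (x r)) (fun r => hub _) n
  refine ⟨k, hkn, hkT.trans ?_, le_trans ?_ htG, ?_⟩
  · gcongr
    have h1 := hS x (n - 1) (fun i hi => ?_) fun i hi => ?_
    · refine le_trans (le_of_eq ?_) h1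
      obtain ⟨m, rfl⟩ : ∃ m, n = m + 1 := ⟨n - 1, by omega⟩
      rw [Finset.sum_range_succ, add_tsub_cancel_right]
      have : x (m + 1) = x m := by simp [x]
      rw [this, sub_self, abs_zero, add_zero]
    · rw [hx i (by omega), hx (i + 1) (by omega)]
      push_cast
      gcongr
      linarith
    · rw [hx i (by omega)]
      exact htS i (by omega)
  · rw [Nat.cast_le]
    refine Finset.card_le_card fun r hr => ?_
    simp only [mixedRows, Finset.mem_filter, Finset.mem_range, mem_ofPred_eq] at hr ⊢
    refine ⟨hr.1, ?_⟩
    rw [← hx r hr.1]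
    have h1 : u (x r) ≠ 0 := fun h => by have := hk0 r h; omega
    have h2 : u (x r) ≠ 1 := fun h => by have := hk1 r h; omega
    exact ⟨lt_of_le_of_ne (hub _).1 h1.symm, lt_of_le_of_ne (hub _).2 h2⟩
  · have h1 := sum_integral_rows_le hu hub hSae hS hn ht htS
    have hui : ∀ a b, IntervalIntegrable u volume a b := fun a b =>
      intervalIntegrable_of_bounded (K := 1) hu
        (fun y => abs_le.2 ⟨by linarith [(hub y).1], (hub y).2⟩) a b
    -- Rounding errs by at most 1/n² per row, hence 1/n in total; the sampling error is bounded by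
    -- T/n.
    have h2 : ∀ r ∈ Finset.range n,
        |(k r : ℝ) / (n : ℝ) ^ 2 - ∫ x in ((r : ℝ) / n)..(((r : ℝ) + 1) / n), u x| ≤
          1 / (n : ℝ) ^ 2 + ∫ x in ((r : ℝ) / n)..(((r : ℝ) + 1) / n),
            |u (((r : ℝ) + t) / n) - u x| := by
      intro r hr
      rw [Finset.mem_range] at hr
      have hle : (r : ℝ) / n ≤ ((r : ℝ) + 1) / n := by gcongr; linarith
      have h3 : |(k r : ℝ) / (n : ℝ) ^ 2 - u (((r : ℝ) + t) / n) / n| ≤ 1 / (n : ℝ) ^ 2 := by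
        have h4 := hku r
        rw [hx r hr] at h4
        have h5 : (k r : ℝ) / (n : ℝ) ^ 2 - u (((r : ℝ) + t) / n) / n =
            (k r - n * u (((r : ℝ) + t) / n)) / (n : ℝ) ^ 2 := by field_simp
        rw [h5, abs_div, abs_of_pos (by positivity : (0 : ℝ) < (n : ℝ) ^ 2)]
        gcongr
      have h6 : u (((r : ℝ) + t) / n) / n - ∫ x in ((r : ℝ) / n)..(((r : ℝ) + 1) / n), u x =
          ∫ x in ((r : ℝ) / n)..(((r : ℝ) + 1) / n), (u (((r : ℝ) + t) / n) - u x) := by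
        rw [intervalIntegral.integral_sub (by simp) (hui _ _), intervalIntegral.integral_const,
          smul_eq_mul]
        congr 1
        field_simp
        ring
      have h7 : |u (((r : ℝ) + t) / n) / n - ∫ x in ((r : ℝ) / n)..(((r : ℝ) + 1) / n), u x| ≤
          ∫ x in ((r : ℝ) / n)..(((r : ℝ) + 1) / n), |u (((r : ℝ) + t) / n) - u x| := by
        rw [h6]
        exact intervalIntegral.abs_integral_le_integral_abs hle
      exact (abs_sub_le _ _ _).trans (add_le_add h3 h7)
    refine (Finset.sum_le_sum h2).trans ?_
    rw [Finset.sum_add_distrib, Finset.sum_const, Finset.card_range, nsmul_eq_mul]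
    have h8 : (n : ℝ) * (1 / (n : ℝ) ^ 2) = 1 / n := by field_simp
    rw [h8, add_div]
    linarith

/-! ### Recovery sequences -/

lemma siteValues_stepFun {n : ℕ} (b : ℕ → ℝ) {i : ℕ} (hi : i < n ^ 2) :
    siteValues n (stepFun (n ^ 2) b) i = b i := by
  have hN : (0 : ℝ) < (n ^ 2 : ℕ) := by exact_mod_cast (by omega : 0 < n ^ 2)
  rw [siteValues]
  refine stepFun_of_mem_cell b hi ⟨?_, ?_⟩
  · push_cast at hN ⊢
    gcongr
    linarith
  · push_cast
    exact le_rfl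

lemma stepFun_mem_spinFunctions {n : ℕ} {b : ℕ → ℝ} (hb : ∀ i, b i = 0 ∨ b i = 1) :
    stepFun (n ^ 2) b ∈ spinFunctions n := by
  constructor
  · intro x hx
    rw [stepFun, if_pos hx]
    exact hb _
  · intro i hi x hx y hy
    rw [Finset.mem_Icc] at hi
    have h1 : ∀ z ∈ Ioc (((i : ℝ) - 1) / (n : ℝ) ^ 2) ((i : ℝ) / (n : ℝ) ^ 2),
        stepFun (n ^ 2) b z = b (i - 1) := by
      intro z hz
      refine stepFun_of_mem_cell b (by omega) ?_
      rw [Nat.cast_sub hi.1]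
      push_cast
      rwa [sub_add_cancel]
    rw [h1 x hx, h1 y hy]

lemma spinEnergy_stepFun {n : ℕ} (hn : 2 ≤ n) (b : ℕ → ℝ) :
    spinEnergy n (stepFun (n ^ 2) b) =
      (1 / (n : ℝ)) * (horizontalJumps n b + verticalJumps n b) := by
  rw [spinEnergy_eq hn, horizontalJumps, horizontalJumps, verticalJumps, verticalJumps]
  congr 2 <;> refine Finset.sum_congr rfl fun i hi => ?_ <;> rw [Finset.mem_range] at hi <;>
    rw [siteValues_stepFun b (by omega), siteValues_stepFun b (by omega)]

lemma abs_stepFun_le {N : ℕ} {b : ℕ → ℝ} (hb : ∀ i, b i = 0 ∨ b i = 1) (x : ℝ) :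
    0 ≤ stepFun N b x ∧ stepFun N b x ≤ 1 := by
  rw [stepFun]
  split_ifs
  · rcases hb (⌈(N : ℝ) * x⌉₊ - 1) with h | h <;> rw [h] <;> norm_num
  · norm_num

lemma integral_row_stepFun {n : ℕ} {k : ℕ → ℕ} (hk : ∀ r, k r ≤ n) {r : ℕ} (hr : r < n) :
    ∫ x in ((r : ℝ) / n)..(((r : ℝ) + 1) / n), stepFun (n ^ 2) (rowConfig n k) x =
      (k r : ℝ) / (n : ℝ) ^ 2 := by
  have hn' : (0 : ℝ) < n := by exact_mod_cast (Nat.zero_le r).trans_lt hr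
  have hi : ∀ a b, IntervalIntegrable (stepFun (n ^ 2) (rowConfig n k)) volume a b := fun a b =>
    intervalIntegrable_of_bounded (K := 1) (measurable_stepFun _ _) (fun x => by
      have := abs_stepFun_le (N := n ^ 2) (rowConfig_eq_zero_or_one n k) x
      rw [abs_of_nonneg this.1]; exact this.2) a b
  have h1 : ∀ m : ℕ, (m : ℝ) / n = ((n * m : ℕ) : ℝ) / (n ^ 2 : ℕ) := fun m => by
    push_cast; field_simp
  have h2 := h1 (r + 1)
  push_cast at h2
  rw [← intervalIntegral.integral_interval_sub_left (hi 0 _) (hi 0 _), h1 r,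
    show ((r : ℝ) + 1) / n = ((n * r + n : ℕ) : ℝ) / (n ^ 2 : ℕ) by push_cast; field_simp,
    integral_eq_sum_cells _ _ hi, integral_eq_sum_cells _ _ hi, Finset.sum_range_add,
    add_sub_cancel_left]
  have h3 : ∀ c ∈ Finset.range n,
      ∫ x in (((n * r + c : ℕ) : ℝ) / (n ^ 2 : ℕ))..((((n * r + c : ℕ) : ℝ) + 1) / (n ^ 2 : ℕ)),
        stepFun (n ^ 2) (rowConfig n k) x = (if c < k r then (1 : ℝ) else 0) / (n ^ 2 : ℕ) := by
    intro c hc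
    rw [Finset.mem_range] at hc
    have h4 : n * r + c < n ^ 2 := by nlinarith
    refine integral_cell_const h4 fun x hx => ?_
    rw [stepFun_of_mem_cell _ h4 hx, rowConfig_mul_add k r hc]
  rw [Finset.sum_congr rfl h3, ← Finset.sum_div, sum_indicator_lt (hk r)]
  push_cast
  rfl

/-- On each row g is within ε of its value at the left end, so only the row integrals of f matter,
up to a total error ε. -/
lemma abs_integral_mul_le_of_rows {f g : ℝ → ℝ} (hf : Measurable f) (hfb : ∀ x, |f x| ≤ 1)
    (hg : Continuous g) {M ε e : ℝ} (hM : ∀ x, |g x| ≤ M) {n : ℕ} (hn : 0 < n)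
    (hosc : ∀ x y : ℝ, |x - y| ≤ 1 / n → |g x - g y| ≤ ε)
    (hrows : ∑ r ∈ Finset.range n, |∫ x in ((r : ℝ) / n)..(((r : ℝ) + 1) / n), f x| ≤ e) :
    |∫ x in (0 : ℝ)..1, f x * g x| ≤ ε + M * e := by
  have hn' : (0 : ℝ) < n := by exact_mod_cast hn
  have hM0 : 0 ≤ M := (abs_nonneg _).trans (hM 0)
  have hfi : ∀ a b, IntervalIntegrable f volume a b := intervalIntegrable_of_bounded hf hfb
  have hfg : ∀ a b, IntervalIntegrable (fun x => f x * g x) volume a b := fun a b =>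
    (hfi a b).mul_continuousOn hg.continuousOn
  have h1 := integral_eq_sum_cells (N := n) (fun x => f x * g x) n hfg
  rw [div_self hn'.ne'] at h1
  rw [h1]
  refine (Finset.abs_sum_le_sum_abs _ _).trans ?_
  have h2 : ∀ r ∈ Finset.range n,
      |∫ x in ((r : ℝ) / n)..(((r : ℝ) + 1) / n), f x * g x| ≤
        ε * (1 / n) + M * |∫ x in ((r : ℝ) / n)..(((r : ℝ) + 1) / n), f x| := by
    intro r _
    have hlen : ((r : ℝ) + 1) / n - r / n = 1 / n := by ring
    have hpos : 0 < 1 / (n : ℝ) := by positivity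
    have hc : Continuous fun x => g x - g (r / n) := hg.sub continuous_const
    have h3 : ∫ x in ((r : ℝ) / n)..(((r : ℝ) + 1) / n), f x * g x =
        (∫ x in ((r : ℝ) / n)..(((r : ℝ) + 1) / n), f x * (g x - g (r / n))) +
          g (r / n) * ∫ x in ((r : ℝ) / n)..(((r : ℝ) + 1) / n), f x := by
      rw [← intervalIntegral.integral_const_mul, ← intervalIntegral.integral_add
        ((hfi _ _).mul_continuousOn hc.continuousOn)
        ((hfi _ _).const_mul _)]
      congr 1
      funext x
      ring
    rw [h3]
    refine (abs_add_le _ _).trans (add_le_add ?_ ?_)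
    · have h4 := intervalIntegral.norm_integral_le_of_norm_le_const (a := (r : ℝ) / n)
        (b := ((r : ℝ) + 1) / n) (C := ε) (f := fun x => f x * (g x - g (r / n))) ?_
      · rwa [hlen, abs_of_pos hpos, Real.norm_eq_abs] at h4
      · intro x hx
        rw [uIoc_of_le (by linarith)] at hx
        rw [Real.norm_eq_abs, abs_mul]
        refine (mul_le_of_le_one_left (abs_nonneg _) (hfb x)).trans (hosc _ _ ?_)
        rw [abs_of_pos (by linarith [hx.1])]
        linarith [hx.2]
    · rw [abs_mul]
      gcongr
      exact hM _
  refine (Finset.sum_le_sum h2).trans ?_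
  rw [Finset.sum_add_distrib, Finset.sum_const, Finset.card_range, nsmul_eq_mul, ← Finset.mul_sum]
  have h5 : (n : ℝ) * (ε * (1 / n)) = ε := by field_simp
  rw [h5]
  gcongr

lemma tendsto_integral_of_rows {f : ℕ → ℝ → ℝ} {u g : ℝ → ℝ} (hf : ∀ n, Measurable (f n))
    (hfb : ∀ n x, 0 ≤ f n x ∧ f n x ≤ 1) (hu : Measurable u) (hub : ∀ x, 0 ≤ u x ∧ u x ≤ 1)
    {C : ℝ} (hrows : ∀ n, 0 < n → ∑ r ∈ Finset.range n,
      |∫ x in ((r : ℝ) / n)..(((r : ℝ) + 1) / n), (f n x - u x)| ≤ C / n)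
    (hg : Continuous g) (hgc : HasCompactSupport g) :
    Tendsto (fun n => ∫ x in (0 : ℝ)..1, f n x * g x) atTop (𝓝 (∫ x in (0 : ℝ)..1, u x * g x)) := by
  obtain ⟨M, hM⟩ := hg.bounded_above_of_compact_support hgc
  have huc := hgc.uniformContinuous_of_continuous hg
  have hi : ∀ w : ℝ → ℝ, Measurable w → (∀ x, 0 ≤ w x ∧ w x ≤ 1) →
      IntervalIntegrable (fun x => w x * g x) volume 0 1 := fun w hw hwb =>
    (intervalIntegrable_of_bounded (K := 1) hw (fun x => by
      rw [abs_of_nonneg (hwb x).1]; exact (hwb x).2) 0 1).mul_continuousOn hg.continuousOn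
  rw [Metric.tendsto_atTop']
  intro ε hε
  obtain ⟨δ, hδ, hδg⟩ := Metric.uniformContinuous_iff.1 huc (ε / 2) (by positivity)
  have t1 : ∀ᶠ n : ℕ in atTop, 1 / (n : ℝ) < δ :=
    tendsto_one_div_atTop_nhds_zero_nat.eventually_lt_const hδ
  have t2 : ∀ᶠ n : ℕ in atTop, M * (C / n) < ε / 2 := by
    have := (tendsto_const_div_atTop_nhds_zero_nat C).const_mul M
    rw [mul_zero] at this
    exact this.eventually_lt_const (by positivity)
  obtain ⟨K, hK⟩ := eventually_atTop.1 (t1.and (t2.and (eventually_gt_atTop 0)))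
  refine ⟨K, fun n hn => ?_⟩
  obtain ⟨k1, k2, k3⟩ := hK n hn.le
  have h1 := abs_integral_mul_le_of_rows (f := fun x => f n x - u x) ((hf n).sub hu)
    (fun x => abs_le.2 ⟨by linarith [(hfb n x).1, (hub x).2], by linarith [(hfb n x).2, (hub x).1]⟩)
    hg (M := M) (ε := ε / 2) (fun x => hM x) k3
    (fun x y hxy => by
      have := hδg (a := x) (b := y) (by rw [Real.dist_eq]; linarith)
      rw [Real.dist_eq] at this
      exact this.le) (hrows n k3)
  rw [Real.dist_eq, ← intervalIntegral.integral_sub (hi _ (hf n) (hfb n)) (hi _ hu hub)]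
  simp_rw [← sub_mul]
  linarith

lemma totalVar_congr {u v : ℝ → ℝ} (h : u =ᵐ[leb01] v) : totalVar u = totalVar v := by
  simp only [totalVar]
  refine iSup_congr fun φ => iSup_congr fun _ => ?_
  congr 1
  exact integral_congr_ae (h.mul (ae_eq_refl _))

lemma spinEnergy_rowConfig_le {n : ℕ} (hn : 2 ≤ n) {k : ℕ → ℕ} (hk : ∀ r, k r ≤ n) {T G : ℝ}
    (hT : ∑ r ∈ Finset.range n, |(k (r + 1) : ℝ) - k r| ≤ n * T)
    (hG : ((mixedRows n k).card : ℝ) ≤ n * G) :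
    spinEnergy n (stepFun (n ^ 2) (rowConfig n k)) ≤ 2 * G + T + (1 + 2 * T) / n := by
  have hn' : (0 : ℝ) < n := by exact_mod_cast (by omega : 0 < n)
  have hH := horizontalJumps_rowConfig_le (by omega) hk
  have hV : verticalJumps n (rowConfig n k) ≤ n * T := by
    rw [verticalJumps_rowConfig hk]
    refine le_trans (Finset.sum_le_sum_of_subset_of_nonneg ?_ fun _ _ _ => abs_nonneg _) hT
    exact Finset.range_subset_range.2 (by omega)
  have hT' : (∑ r ∈ Finset.range n, |(k (r + 1) : ℝ) - k r|) / n ≤ T := by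
    rw [div_le_iff₀ hn']; linarith
  rw [spinEnergy_stepFun hn]
  have h1 : 2 * G + T + (1 + 2 * T) / n = (1 / n) * ((1 + 2 * (n * G + T)) + n * T) := by
    field_simp
    ring
  rw [h1]
  gcongr
  linarith

/-- Existence of recovery sequences. -/
lemma exists_recovery (u : Linf01) :
    ∃ y : ℕ → Linf01, WeakStarConv y u ∧
      limsup (fun n => discreteFunctional n (y n)) atTop ≤ limitFunctional u := by
  by_cases hfin : MemBV u ∧ ∀ᵐ x ∂leb01, 0 ≤ u x ∧ u x ≤ 1
  swap
  · refine ⟨fun _ => u, fun g _ => tendsto_const_nhds, ?_⟩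
    rw [limitFunctional, if_neg hfin]
    exact le_top
  set u₀ : ℝ → ℝ := fun x => max 0 (min 1 (u x))
  have hu₀ : Measurable u₀ :=
    measurable_const.max (measurable_const.min (Lp.stronglyMeasurable u).measurable)
  have hub : ∀ x, 0 ≤ u₀ x ∧ u₀ x ≤ 1 := fun x =>
    ⟨le_max_left _ _, max_le zero_le_one (min_le_left _ _)⟩
  have huu : u =ᵐ[leb01] u₀ := by
    filter_upwards [hfin.2] with x hx
    simp [u₀, hx.1, hx.2]
  have hBV : MemBV u₀ := ⟨hfin.1.1.congr huu, by rw [← totalVar_congr huu]; exact hfin.1.2⟩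
  -- The condition 0 < n is placed inside the existential so that k can be chosen for every n,
  -- including 0.
  have hrows : ∀ n : ℕ, ∃ k : ℕ → ℕ, 0 < n → ((∀ r, k r ≤ n) ∧
      ∑ r ∈ Finset.range n, |(k (r + 1) : ℝ) - k r| ≤ n * (totalVar u₀).toReal ∧
      ((mixedRows n k).card : ℝ) ≤
        n * volume.real {x ∈ Ioo (0 : ℝ) 1 | 0 < u₀ x ∧ u₀ x < 1} ∧
      ∑ r ∈ Finset.range n,
        |(k r : ℝ) / (n : ℝ) ^ 2 - ∫ x in ((r : ℝ) / n)..(((r : ℝ) + 1) / n), u₀ x| ≤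
          (1 + (totalVar u₀).toReal) / n) := fun n => by
    by_cases hn : 0 < n
    · obtain ⟨k, hk⟩ := exists_rows hu₀ hub hBV hn
      exact ⟨k, fun _ => hk⟩
    · exact ⟨fun _ => 0, fun h => absurd h hn⟩
  choose k hk using hrows
  set T := (totalVar u₀).toReal
  set G := volume.real {x ∈ Ioo (0 : ℝ) 1 | 0 < u₀ x ∧ u₀ x < 1}
  set f : ℕ → ℝ → ℝ := fun n => stepFun (n ^ 2) (rowConfig n (k n))
  have hf : ∀ n, Measurable (f n) := fun n => measurable_stepFun _ _
  have hfb : ∀ n x, 0 ≤ f n x ∧ f n x ≤ 1 := fun n x =>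
    abs_stepFun_le (rowConfig_eq_zero_or_one n (k n)) x
  have hfb' : ∀ n x, |f n x| ≤ 1 := fun n x => by
    rw [abs_of_nonneg (hfb n x).1]; exact (hfb n x).2
  have hfm : ∀ n, MemLp (f n) ∞ leb01 := fun n =>
    memLp_top_of_bound (hf n).aestronglyMeasurable 1 (Eventually.of_forall (hfb' n))
  have hye : ∀ n, (hfm n).toLp (f n) =ᵐ[leb01] f n := fun n => (hfm n).coeFn_toLp
  have hui : ∀ w : ℝ → ℝ, Measurable w → (∀ x, 0 ≤ w x ∧ w x ≤ 1) → ∀ a b,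
      IntervalIntegrable w volume a b := fun w hw hwb a b =>
    intervalIntegrable_of_bounded (K := 1) hw (fun x => by
      rw [abs_of_nonneg (hwb x).1]; exact (hwb x).2) a b
  refine ⟨fun n => (hfm n).toLp (f n), weakStarConv_of_continuous
    (Eventually.of_forall fun n => ?_) ?_ fun g hg hgc => ?_, ?_⟩
  · filter_upwards [hye n] with x hx
    rw [hx]
    exact hfb' n x
  · filter_upwards [hfin.2] with x hx
    rw [abs_of_nonneg hx.1]
    exact hx.2
  · have h1 : ∫ x, u x * g x ∂leb01 = ∫ x in (0 : ℝ)..1, u₀ x * g x := by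
      rw [← integral_leb01]
      exact integral_congr_ae (huu.mul (ae_eq_refl g))
    have h2 : ∀ n, ∫ x, (hfm n).toLp (f n) x * g x ∂leb01 = ∫ x in (0 : ℝ)..1, f n x * g x := by
      intro n
      rw [← integral_leb01]
      exact integral_congr_ae ((hye n).mul (ae_eq_refl g))
    simp_rw [h1, h2]
    refine tendsto_integral_of_rows hf hfb hu₀ hub (C := 1 + T) (fun n hn => ?_) hg hgc
    refine le_trans (le_of_eq ?_) (hk n hn).2.2.2
    refine Finset.sum_congr rfl fun r hr => ?_
    rw [intervalIntegral.integral_sub (hui _ (hf n) (hfb n) _ _) (hui _ hu₀ hub _ _),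
      integral_row_stepFun (hk n hn).1 (Finset.mem_range.1 hr)]
  · have hlim : limitFunctional u = ENNReal.ofReal (2 * G + T) := by
      rw [limitFunctional, if_pos hfin, totalVar_congr huu, volume_between_congr huu,
        ENNReal.ofReal_add (by positivity) ENNReal.toReal_nonneg, ENNReal.ofReal_toReal hBV.2.ne,
        ENNReal.ofReal_mul (by norm_num), ofReal_measureReal (measure_ne_top_of_subset
          (fun x hx => hx.1) (by simp : volume (Ioo (0 : ℝ) 1) ≠ ∞))]
      simp
    have h1 : ∀ᶠ n : ℕ in atTop, discreteFunctional n ((hfm n).toLp (f n)) ≤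
        ENNReal.ofReal (2 * G + T + (1 + 2 * T) / n) := by
      filter_upwards [eventually_ge_atTop 2] with n hn
      obtain ⟨h1, h2, h3, -⟩ := hk n (by omega)
      refine (iInf₂_le_of_le (f n)
        (stepFun_mem_spinFunctions (rowConfig_eq_zero_or_one n (k n))) (iInf_le _ (hye n))).trans ?_
      exact ENNReal.ofReal_le_ofReal (spinEnergy_rowConfig_le hn h1 h2 h3)
    have h2 : Tendsto (fun n : ℕ => ENNReal.ofReal (2 * G + T + (1 + 2 * T) / n)) atTop
        (𝓝 (ENNReal.ofReal (2 * G + T))) := by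
      refine ENNReal.tendsto_ofReal ?_
      have := (tendsto_const_div_atTop_nhds_zero_nat (1 + 2 * T)).const_add (2 * G + T)
      rwa [add_zero] at this
    rw [hlim, ← h2.limsup_eq]
    exact limsup_le_limsup h1

end SpinGamma

end

theorem mainTheorem1 :
    SpinGamma.GammaConverges SpinGamma.WeakStarConv
      SpinGamma.discreteFunctional SpinGamma.limitFunctional ∧
    (∀ (u : ℕ → SpinGamma.Linf01) (C : ℝ≥0),
      (∀ n : ℕ, 1 ≤ n → SpinGamma.discreteFunctional n (u n) ≤ (C : ℝ≥0∞)) →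
      ∃ (φ : ℕ → ℕ) (v : SpinGamma.Linf01), StrictMono φ ∧
        SpinGamma.MemBV v ∧
        SpinGamma.WeakStarConv (fun k => u (φ k)) v ∧
        SpinGamma.limitFunctional v ≤
          liminf (fun n => SpinGamma.discreteFunctional n (u n)) atTop) :=
  ⟨⟨fun _ _ h => SpinGamma.limitFunctional_le_liminf h, SpinGamma.exists_recovery⟩,
    SpinGamma.compactness⟩
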